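/- Fix $K\in\mathbb N$, $\alpha\ge 0$, $0<\Delta_1\le\Delta_2<\infty$ and $0<f_{\max}<\infty$, and write $\bar P=\sqrt P$, $[m]=\{1,\dots,m\}$. **Model.** Real setting: the channel coefficients $G_{kl}(t)$ ($k,l\in[K]$, $t\in\mathbb N$) are real random variables with $\Delta_1\le|G_{kl}(t)|\le\Delta_2$ almost surely, and the family $\mathcal G=\{G_{kl}(t)\}$ satisfies the bounded density assumption: for all finite disjoint $\mathcal A_1,\mathcal A_2\subset\mathcal G$ the conditional density $f_{\mathcal A_1|\mathcal A_2}$ exists and is at most $f_{\max}^{|\mathcal A_1|}$. For $P\ge 1$ and $n\in\mathbb N$, the inputs $\bar X_l(t)$, $l\in[K]$, $t\in[n]$, are random variables with values in $\{0,1,\dots,\lceil\bar P^{\max(1,\alpha)}\rceil\}$, independent of $\mathcal G$ and otherwise arbitrary, and the outputs are $$\bar Y_k(t)=\sum_{l\in[K],\,l\ne k}\lceil\bar P^{\alpha-\max(1,\alpha)}G_{kl}(t)\bar X_l(t)\rceil+\lceil\bar P^{1-\max(1,\alpha)}G_{kk}(t)\bar X_k(t)\rceil .$$ The reference capacity is $C_o(P)=\tfrac12\log(1+P)$.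 Complex setting: $G_{kl}(t)$ is complex with the same bounds on its modulus, the bounded density assumption holds for the family of all real and imaginary parts of the $G_{kl}(t)$, real and imaginary parts of the inputs take values in $\{0,\dots,\lceil\bar P^{\max(1,\alpha)}\rceil\}$, $\lceil\cdot\rceil$ rounds up real and imaginary parts separately, and $C_o(P)=\log(1+P)$. Write $Z^{[n]}=(Z(1),\dots,Z(n))$, let $G^{[n]}$ be all the coefficients at times $t\in[n]$, $\bar X_{1:k}=(\bar X_1,\dots,\bar X_k)$, and let $H$ denote (conditional) Shannon entropy in nats. **Claim.** There is a function $\varepsilon$ with $\varepsilon(P)=o(\log P)$ as $P\to\infty$, depending only on $K,\alpha,\Delta_1,\Delta_2,f_{\max}$, such that in both settings, for all $n$, all $P\ge1$, and all channel coefficients and inputs as above, the following hold. 1. If $\alpha\le1$, then for all $k,l\in[K]$, $$H(\bar Y_k^{[n]}\mid G^{[n]})-H(G_{lk}^{[n]}\bar X_k^{[n]}\mid G^{[n]})\le n\alpha\,C_o(P)+n\,\varepsilon(P),$$ both with the exact products $G_{lk}(t)\bar X_k(t)$ and with the rounded products $\lceil G_{lk}(t)\bar X_k(t)\rceil$ in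 the second entropy. 2. If $\alpha\le1$, then for all $k\in[K-1]$, $$H(\bar Y_{k+1}^{[n]}\mid\bar X_{1:k}^{[n]},G^{[n]})-H(\bar Y_k^{[n]}\mid\bar X_{1:k}^{[n]},G^{[n]})\le n(1-\alpha)\,C_o(P)+n\,\varepsilon(P).$$ 3. If $\alpha>1$, then for all $k\in[K-1]$, $$H(\bar Y_{k+1}^{[n]}\mid\bar X_{1:k}^{[n]},G^{[n]})-H(\bar Y_k^{[n]}\mid\bar X_{1:k}^{[n]},G^{[n]})\le n\,\varepsilon(P).$$ -/

import Mathlib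

open MeasureTheory ProbabilityTheory Filter Asymptotics
open scoped ENNReal

namespace SymIC

noncomputable section

/-- Shannon entropy (in nats) of a discrete probability measure `ν`:
`-∑ ν{s} log ν{s}`, the sum running over the atoms of `ν`. -/
def entropy {S : Type*} [MeasurableSpace S] (ν : Measure S) : ℝ :=
  ∑' s : S, Real.negMulLog (ν.real {s})

/-- Conditional Shannon entropy `H(A | B)`: the average over the values `b` of `B` of the
entropy of the conditional law of `A` given `B = b`. Here `B` may be a continuous random variable;
`A` only has to be discrete conditionally on `B`. -/
def condEntropy {Ω S T : Type*} [MeasurableSpace Ω] [MeasurableSpace S] [StandardBorelSpace S]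
    [Nonempty S] [MeasurableSpace T] (μ : Measure Ω) [IsFiniteMeasure μ]
    (A : Ω → S) (B : Ω → T) : ℝ :=
  ∫ b, entropy (condDistrib A B μ b) ∂(μ.map B)

/-- Bounded density assumption with constant `fmax`, for a family `A` of real random variables:
for all finite disjoint sets `S`, `T` of members, the conditional law of `(A i)_{i ∈ S}` given
`(A j)_{j ∈ T}` has a density with respect to Lebesgue measure, bounded by `fmax ^ |S|`. -/
def BoundedDensity {Ω ι : Type*} [MeasurableSpace Ω] (μ : Measure Ω) [IsFiniteMeasure μ]
    (A : ι → Ω → ℝ) (fmax : ℝ) : Prop :=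
  ∀ S T : Finset ι, Disjoint S T →
    ∀ᵐ y ∂(μ.map (fun ω (j : T) => A j ω)),
      ∃ f : (S → ℝ) → ℝ≥0∞, Measurable f ∧ (∀ x, f x ≤ ENNReal.ofReal (fmax ^ S.card)) ∧
        condDistrib (fun ω (i : S) => A i ω) (fun ω (j : T) => A j ω) μ y = volume.withDensity f

/-- Capacity (in nats) of the real channel `Y = X + N`, power `P`, unit variance noise. -/
def realCapacity (P : ℝ) : ℝ := 1 / 2 * Real.log (1 + P)

/-- Capacity (in nats) of the complex channel `Y = X + N`, power `P`, unit variance noise. -/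
def complexCapacity (P : ℝ) : ℝ := Real.log (1 + P)

section Model

/-! The model is written once for `𝕜 = ℝ` and `𝕜 = ℂ`; for `𝕜 = ℝ` the imaginary unit
`RCLike.I` and all imaginary parts are zero. -/

variable {𝕜 : Type*} [RCLike 𝕜]

/-- Rounding up; for complex numbers, the real and the imaginary part are rounded up. -/
def ceil (z : 𝕜) : 𝕜 := (⌈RCLike.re z⌉ : 𝕜) + (⌈RCLike.im z⌉ : 𝕜) * RCLike.I

/-- The input alphabet: numbers `a` in the real case and `a + b i` in the complex case, with
`a, b ∈ {0, 1, …, ⌈(√P) ^ max 1 α⌉}`. -/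
def inputAlphabet (𝕜 : Type*) [RCLike 𝕜] (P α : ℝ) : Set 𝕜 :=
  {x | ∃ a b : ℤ, 0 ≤ a ∧ a ≤ ⌈(√P) ^ max 1 α⌉ ∧ 0 ≤ b ∧ b ≤ ⌈(√P) ^ max 1 α⌉ ∧
    x = (a : 𝕜) + (b : 𝕜) * RCLike.I}

variable {Ω : Type*} {K n : ℕ}

/-- The output sequence `(Ȳ_k(t))_{t}` of receiver `k` over `n` channel uses; `G t k l` is the
coefficient from transmitter `l` to receiver `k` at time `t`, and `X l t` is the input of
transmitter `l` at time `t`. -/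
def output (P α : ℝ) (G : ℕ → Fin K → Fin K → Ω → 𝕜) (X : Fin K → Fin n → Ω → 𝕜)
    (k : Fin K) (ω : Ω) : Fin n → 𝕜 := fun t =>
  (∑ l ∈ Finset.univ.erase k,
      ceil (((√P) ^ (α - max 1 α) : ℝ) * G t k l ω * X l t ω))
    + ceil (((√P) ^ (1 - max 1 α) : ℝ) * G t k k ω * X k t ω)

/-- All channel coefficients over the first `n` channel uses. -/
def channelBlock (n : ℕ) (G : ℕ → Fin K → Fin K → Ω → 𝕜) (ω : Ω) :
    Fin n → Fin K → Fin K → 𝕜 := fun t k l => G t k l ω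

/-- The input sequences of the first users, up to and including the user with (zero-based)
index `k`. -/
def inputsUpTo (k : ℕ) (X : Fin K → Fin n → Ω → 𝕜) (ω : Ω) :
    {j : Fin K // (j : ℕ) ≤ k} → Fin n → 𝕜 := fun j t => X j t ω

/-- The sequence of exact products `G_{lk}(t) X̄_k(t)`. -/
def scaledInput (G : ℕ → Fin K → Fin K → Ω → 𝕜) (X : Fin K → Fin n → Ω → 𝕜)
    (l k : Fin K) (ω : Ω) : Fin n → 𝕜 := fun t => G t l k ω * X k t ω

/-- The sequence of rounded products `⌈G_{lk}(t) X̄_k(t)⌉`. -/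
def roundedScaledInput (G : ℕ → Fin K → Fin K → Ω → 𝕜) (X : Fin K → Fin n → Ω → 𝕜)
    (l k : Fin K) (ω : Ω) : Fin n → 𝕜 := fun t => ceil (G t l k ω * X k t ω)

variable [MeasurableSpace Ω] [MeasurableSpace 𝕜]

/-- The channel coefficients are random variables with `Δ₁ ≤ |G_{kl}(t)| ≤ Δ₂`. -/
structure IsChannel (μ : Measure Ω) (Δ₁ Δ₂ : ℝ) (G : ℕ → Fin K → Fin K → Ω → 𝕜) : Prop where
  measurable : ∀ t k l, Measurable (G t k l)
  bounded : ∀ t k l, ∀ᵐ ω ∂μ, Δ₁ ≤ ‖G t k l ω‖ ∧ ‖G t k l ω‖ ≤ Δ₂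

/-- The inputs are random variables with values in the input alphabet, independent of the channel
coefficients (the transmitters do not know the realization of the channel). The joint law of the
inputs, across users and channel uses, is otherwise arbitrary. -/
structure IsInput (μ : Measure Ω) (P α : ℝ) (G : ℕ → Fin K → Fin K → Ω → 𝕜)
    (X : Fin K → Fin n → Ω → 𝕜) : Prop where
  measurable : ∀ k t, Measurable (X k t)
  mem_alphabet : ∀ k t, ∀ᵐ ω ∂μ, X k t ω ∈ inputAlphabet 𝕜 P α
  indep : IndepFun (fun ω k t => X k t ω) (fun ω t k l => G t k l ω) μ

end Model

/-- The set of channel coefficient variables in the real setting. -/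
def realCoefficients {Ω : Type*} {K : ℕ} (G : ℕ → Fin K → Fin K → Ω → ℝ) :
    ℕ × Fin K × Fin K → Ω → ℝ := fun i ω => G i.1 i.2.1 i.2.2 ω

/-- The set of channel coefficient variables in the complex setting: all real parts together with
all imaginary parts. -/
def complexCoefficients {Ω : Type*} {K : ℕ} (G : ℕ → Fin K → Fin K → Ω → ℂ) :
    (ℕ × Fin K × Fin K) ⊕ (ℕ × Fin K × Fin K) → Ω → ℝ :=
  Sum.elim (fun i ω => (G i.1 i.2.1 i.2.2 ω).re) (fun i ω => (G i.1 i.2.1 i.2.2 ω).im)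

end

end SymIC

open SymIC

/-! All claims come from one comparison. Let `a g` and `b g` be functions of the inputs `x`, let `p`
be the law of the inputs, and let `m_a(x)`, `m_b(x)` be the masses of the fibres of `a g`, `b g`
through `x` within `w = w x`. Since inputs and channel are independent, H(a | w, G) - H(b | w, G) is
the mean of log (m_b / m_a), hence at most the logarithm of the mean of m_b / m_a. Expanding m_b(x)
as a sum over `x'` with `b g x' = b g x` turns this mean into a double sum of collision events
weighted by 1 / m_a(x).

If the collision probability, conditionally on what determines `a`, is at most a decreasing function
φ of the distance between `a g x` and `a g x'` (a product of φ^d over time), then for fixed `x'` the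
weights p(x) / m_a(x) sum to at most one on each fibre of `a`. The input law disappears, leaving a
sum of φ over lattice points, at most M^(dn). The exponent `d` is 1 in the real and 2 in the complex
setting. This is `condEntropy_sub_le_log`.

For the first claim, `b` is the exact or rounded product. A collision forces the inputs of user `k`
to within 2 / Δ₁, so the outputs differ by at most a constant times (√P)^α. Here φ is an indicator
and M is of order (√P)^α.

For the other two claims, `a` and `b` are the outputs of different receivers and `w` reveals the
input of the receiver `k` of `b`. At each time, a collision at `k` puts the coefficient of the
largest input difference D in a ball of radius proportional to 1 / ((√P)^(α - max 1 α) D). That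
coefficient belongs to a cross link and does not enter the other output, so the bounded density
gives probability at most (v / D)^d. The other output moves by at most a constant times D, so φ(r)
is proportional to 1 / (1 + r). Its lattice sum is logarithmic in P, which costs only log log P in
the entropy. -/

namespace SymIC

/-! ### Conditional entropy as an average over a finite input law. -/

open scoped Classical in
/-- The entropy of a finite combination of Dirac masses. -/
lemma entropy_sum_dirac {X S : Type*} [MeasurableSpace S] [MeasurableSingletonClass S]
    (s : Finset X) (q : X → ℝ) (hq : ∀ x ∈ s, 0 ≤ q x) (f : X → S) :
    entropy (∑ x ∈ s, ENNReal.ofReal (q x) • Measure.dirac (f x)) =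
      -∑ x ∈ s, q x * Real.log (∑ x' ∈ s with f x' = f x, q x') := by
  have hmass : ∀ y, (∑ x ∈ s, ENNReal.ofReal (q x) • Measure.dirac (f x)).real {y}
      = ∑ x ∈ s with f x = y, q x := by
    intro y
    rw [measureReal_def, Measure.finsetSum_apply, ENNReal.toReal_sum, Finset.sum_filter]
    · refine Finset.sum_congr rfl fun x hx => ?_
      rw [Measure.smul_apply, Measure.dirac_apply' _ (measurableSet_singleton y)]
      by_cases h : f x = y <;> simp [h, hq x hx]
    · intro x _
      rw [Measure.smul_apply, Measure.dirac_apply' _ (measurableSet_singleton y)]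
      by_cases h : f x = y <;> simp [h]
  unfold entropy
  simp_rw [hmass]
  rw [tsum_eq_sum (s := s.image f), ← Finset.sum_neg_distrib,
    ← Finset.sum_fiberwise_of_maps_to (fun x hx => Finset.mem_image_of_mem f hx)]
  · refine Finset.sum_congr rfl fun y _ => ?_
    rw [Real.negMulLog, neg_mul, Finset.sum_neg_distrib, Finset.sum_mul]
    congr 1
    refine Finset.sum_congr rfl fun x hx => ?_
    rw [(Finset.mem_filter.1 hx).2]
  · intro y hy
    rw [Finset.filter_eq_empty_iff.2, Finset.sum_empty, Real.negMulLog_zero]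
    intro x hx h
    exact hy (h ▸ Finset.mem_image_of_mem f hx)

section Law

variable {Ω 𝕏 𝔾 : Type*} [MeasurableSpace Ω] [MeasurableSpace 𝕏] [MeasurableSpace 𝔾]
  [MeasurableSingletonClass 𝕏]

/-- The joint law of independent `X` and `G`, with `X` almost surely in a finite set. -/
lemma map_prodMk_eq_sum_of_indepFun {μ : Measure Ω} {X : Ω → 𝕏} {G : Ω → 𝔾}
    (hX : Measurable X) (hG : Measurable G) (hXG : IndepFun X G μ) {s : Finset 𝕏}
    (hs : ∀ᵐ ω ∂μ, X ω ∈ s) :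
    μ.map (fun ω => (X ω, G ω)) = ∑ x ∈ s, μ (X ⁻¹' {x}) • (μ.map G).map (Prod.mk x) := by
  ext t ht
  rw [Measure.map_apply (hX.prodMk hG) ht, Measure.finsetSum_apply]
  have hpiece : ∀ x ∈ s, (μ (X ⁻¹' {x}) • (μ.map G).map (Prod.mk x)) t
      = μ (X ⁻¹' {x} ∩ G ⁻¹' (Prod.mk x ⁻¹' t)) := by
    intro x _
    have hm : MeasurableSet (Prod.mk x ⁻¹' t) := measurable_prodMk_left ht
    rw [Measure.smul_apply, Measure.map_apply measurable_prodMk_left ht,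
      Measure.map_apply hG hm,
      hXG.measure_inter_preimage_eq_mul _ _ (measurableSet_singleton x) hm, smul_eq_mul]
  rw [Finset.sum_congr rfl hpiece, ← measure_biUnion_finset]
  · refine measure_congr ?_
    filter_upwards [hs] with ω hω
    refine propext ⟨fun h => ?_, fun h => ?_⟩
    · exact Set.mem_iUnion₂.2 ⟨X ω, hω, rfl, h⟩
    · obtain ⟨x, _, hx, h⟩ := Set.mem_iUnion₂.1 h
      obtain rfl : X ω = x := hx
      exact h
  · intro x _ y _ hxy
    refine Set.disjoint_left.2 fun ω h1 h2 => hxy ?_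
    exact (h1.1 : X ω = x).symm.trans h2.1
  · intro x _
    exact (hX (measurableSet_singleton x)).inter (hG (measurable_prodMk_left ht))

lemma sum_measureReal_singleton {μ : Measure Ω} [IsProbabilityMeasure μ] {X : Ω → 𝕏}
    (hX : Measurable X) {s : Finset 𝕏} (hs : ∀ᵐ ω ∂μ, X ω ∈ s) :
    ∑ x ∈ s, μ.real (X ⁻¹' {x}) = 1 := by
  rw [← measureReal_biUnion_finset]
  · rw [measureReal_def, (prob_compl_eq_zero_iff _).1, ENNReal.toReal_one]
    swap
    · exact s.measurableSet_biUnion fun x _ => hX (measurableSet_singleton x)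
    · refine measure_mono_null ?_ hs
      intro ω h h'
      exact h (Set.mem_iUnion₂.2 ⟨X ω, h', rfl⟩)
  · intro x _ y _ hxy
    refine Set.disjoint_left.2 fun ω h1 h2 => hxy ?_
    exact (h1 : X ω = x).symm.trans h2
  · exact fun x _ => hX (measurableSet_singleton x)

/-- A function of a random subset of a finite set is measurable. -/
lemma measurable_comp_filter {𝔾 𝕏 : Type*} [MeasurableSpace 𝔾]
    (s : Finset 𝕏) {Q : 𝔾 → 𝕏 → Prop} [∀ g, DecidablePred (Q g)]
    (hQ : ∀ x ∈ s, MeasurableSet {g | Q g x})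
    (h : Finset 𝕏 → ℝ) : Measurable fun g => h {x ∈ s | Q g x} := by
  classical
  have hA : ∀ A, MeasurableSet {g | {x ∈ s | Q g x} = A} := by
    intro A
    have : {g | {x ∈ s | Q g x} = A} = {_g | A ⊆ s} ∩ ⋂ x ∈ s, {g | Q g x ↔ x ∈ A} := by
      ext g
      simp only [Set.mem_ofPred_eq, Set.mem_inter_iff, Set.mem_iInter]
      constructor
      · rintro rfl
        exact ⟨Finset.filter_subset _ _, fun x hx => by simp [hx]⟩
      · rintro ⟨h1, h2⟩
        ext x
        rw [Finset.mem_filter]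
        exact ⟨fun hx => (h2 x hx.1).1 hx.2, fun hx => ⟨h1 hx, (h2 x (h1 hx)).2 hx⟩⟩
    rw [this]
    refine (MeasurableSet.const _).inter (Finset.measurableSet_biInter _ fun x hx => ?_)
    by_cases hxA : x ∈ A
    · simpa [hxA] using hQ x hx
    · have : {g | Q g x ↔ x ∈ A} = {g | Q g x}ᶜ := by ext; simp [hxA]
      rw [this]
      exact (hQ x hx).compl
  have hsum : (fun g => h {x ∈ s | Q g x})
      = fun g => ∑ A ∈ s.powerset, Set.indicator {g | {x ∈ s | Q g x} = A} (fun _ => h A) g := by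
    ext g
    rw [Finset.sum_eq_single ({x ∈ s | Q g x})]
    · simp
    · intro A _ hne
      exact Set.indicator_of_notMem (fun h => hne h.symm) _
    · intro hn
      exact absurd (Finset.mem_powerset.2 (Finset.filter_subset _ _)) hn
  rw [hsum]
  exact Finset.measurable_sum _ fun A _ => measurable_const.indicator (hA A)

lemma integrable_comp_filter {𝔾 𝕏 : Type*} [MeasurableSpace 𝔾] {ν : Measure 𝔾} [IsFiniteMeasure ν]
    (s : Finset 𝕏) {Q : 𝔾 → 𝕏 → Prop} [∀ g, DecidablePred (Q g)]
    (hQ : ∀ x ∈ s, MeasurableSet {g | Q g x})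
    (h : Finset 𝕏 → ℝ) : Integrable (fun g => h {x ∈ s | Q g x}) ν := by
  refine Integrable.of_bound (measurable_comp_filter s hQ h).aestronglyMeasurable
    (∑ A ∈ s.powerset, ‖h A‖) (ae_of_all _ fun g => ?_)
  exact Finset.single_le_sum (f := fun A => ‖h A‖) (fun A _ => norm_nonneg _)
    (Finset.mem_powerset.2 (Finset.filter_subset _ _))

open scoped Classical in
/-- Conditional entropy of `F G X` given `w X` and `G`, for `X` independent of `G` and almost
surely in a finite set; `e` packs the two conditioning variables into one. -/
theorem condEntropy_eq_integral {V T S : Type*} [MeasurableSpace V] [MeasurableSingletonClass V]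
    [MeasurableSpace T] [MeasurableSpace S] [StandardBorelSpace S] [Nonempty S]
    {μ : Measure Ω} [IsProbabilityMeasure μ] {X : Ω → 𝕏} {G : Ω → 𝔾}
    (hX : Measurable X) (hG : Measurable G) (hXG : IndepFun X G μ) {s : Finset 𝕏}
    (hs : ∀ᵐ ω ∂μ, X ω ∈ s) (hpos : ∀ x ∈ s, 0 < μ.real (X ⁻¹' {x}))
    {w : 𝕏 → V} (hw : Measurable w) {F : 𝔾 → 𝕏 → S}
    (hF : Measurable fun z : 𝕏 × 𝔾 => F z.2 z.1)
    {e : V → 𝔾 → T} (he : Measurable fun z : V × 𝔾 => e z.1 z.2)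
    {v : T → V} {γ : T → 𝔾} (hv : Measurable v) (hγ : Measurable γ)
    (hve : ∀ a g, v (e a g) = a) (hγe : ∀ a g, γ (e a g) = g) :
    condEntropy μ (fun ω => F (G ω) (X ω)) (fun ω => e (w (X ω)) (G ω)) =
      ∫ g, ∑ x ∈ s, μ.real (X ⁻¹' {x}) *
        (Real.log (∑ x' ∈ s with w x' = w x, μ.real (X ⁻¹' {x'}))
          - Real.log (∑ x' ∈ s with F g x' = F g x ∧ w x' = w x, μ.real (X ⁻¹' {x'})))
        ∂(μ.map G) := by
  set p : 𝕏 → ℝ := fun x => μ.real (X ⁻¹' {x}) with hp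
  have hp0 : ∀ x, 0 ≤ p x := fun x => measureReal_nonneg
  set m : V → ℝ := fun a => ∑ x ∈ s with w x = a, p x with hm
  have hm0 : ∀ a, 0 ≤ m a := fun a => Finset.sum_nonneg fun x _ => hp0 x
  have hmpos : ∀ x ∈ s, 0 < m (w x) := fun x hx =>
    (hpos x hx).trans_le (Finset.single_le_sum (f := p) (fun y _ => hp0 y)
      (Finset.mem_filter.2 ⟨hx, rfl⟩))
  -- The conditional weights of the inputs given `w X = a`. By independence they do not involve the
  -- channel.
  set q : 𝕏 → V → ℝ := fun x a => if w x = a then p x / m a else 0 with hq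
  have hq0 : ∀ x a, 0 ≤ q x a := fun x a => by
    simp only [hq]; split_ifs
    · exact div_nonneg (hp0 x) (hm0 _)
    · exact le_rfl
  have hqm : ∀ x ∈ s, Measurable (q x) := fun x _ => by
    have : q x = Set.indicator {w x} (fun _ => p x / m (w x)) := by
      ext a
      by_cases h : w x = a
      · simp [hq, ← h]
      · simp [hq, h, Ne.symm h]
    rw [this]
    exact measurable_const.indicator (measurableSet_singleton _)
  have hFx : ∀ x, Measurable fun g => F g x := fun x => hF.comp measurable_prodMk_left
  have hex : ∀ a, Measurable (e a) := fun a => he.comp measurable_prodMk_left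
  -- averaging the conditional weights
  have hswap : ∀ h : 𝕏 → ℝ, ∑ x ∈ s, p x * ∑ x' ∈ s, q x' (w x) * h x' = ∑ x ∈ s, p x * h x := by
    intro h
    simp_rw [Finset.mul_sum]
    rw [Finset.sum_comm]
    refine Finset.sum_congr rfl fun x' hx' => ?_
    have : ∀ x ∈ s, p x * (q x' (w x) * h x')
        = (if w x = w x' then p x else 0) * (p x' / m (w x') * h x') := by
      intro x _
      by_cases hxx : w x = w x'
      · simp [hq, hxx]
      · simp [hq, hxx, Ne.symm hxx]
    rw [Finset.sum_congr rfl this, ← Finset.sum_mul, ← Finset.sum_filter]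
    have := (hmpos x' hx').ne'
    change m (w x') * _ = _
    field_simp
  -- The explicit candidate for the conditional law: push the weights `q · (v b)` forward under `F
  -- (γ b)`. Uniqueness of disintegrations then identifies it with `condDistrib` almost everywhere.
  let κ : Kernel T S :=
    { toFun := fun b => ∑ x ∈ s, ENNReal.ofReal (q x (v b)) • Measure.dirac (F (γ b) x)
      measurable' := by
        refine Measure.measurable_of_measurable_coe _ fun t ht => ?_
        simp only [Measure.finsetSum_apply, Measure.smul_apply, smul_eq_mul]
        refine Finset.measurable_sum _ fun x hx => ?_
        refine Measurable.mul ?_ ?_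
        · exact ((hqm x hx).comp hv).ennreal_ofReal
        · simp only [Measure.dirac_apply' _ ht]
          exact (measurable_one.indicator ht).comp ((hFx x).comp hγ) }
  have hκ : ∀ b, κ b = ∑ x ∈ s, ENNReal.ofReal (q x (v b)) • Measure.dirac (F (γ b) x) :=
    fun _ => rfl
  have : IsFiniteKernel κ := by
    refine ⟨⟨∑ x ∈ s, ENNReal.ofReal (p x / m (w x)), ENNReal.sum_lt_top.2 fun _ _ =>
      ENNReal.ofReal_lt_top, fun b => ?_⟩⟩
    rw [hκ, Measure.finsetSum_apply]
    refine Finset.sum_le_sum fun x hx => ?_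
    rw [Measure.smul_apply, measure_univ, smul_eq_mul, mul_one]
    refine ENNReal.ofReal_le_ofReal ?_
    simp only [hq]
    split_ifs with h
    · rw [h]
    · exact div_nonneg (hp0 x) (hm0 _)
  have hB : Measurable fun z : 𝕏 × 𝔾 => e (w z.1) z.2 :=
    he.comp ((hw.comp measurable_fst).prodMk measurable_snd)
  have hXGm := hX.prodMk hG
  have hlaw := map_prodMk_eq_sum_of_indepFun hX hG hXG hs
  have hcond : condDistrib (fun ω => F (G ω) (X ω)) (fun ω => e (w (X ω)) (G ω)) μ
      =ᵐ[μ.map (fun ω => e (w (X ω)) (G ω))] κ := by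
    refine condDistrib_ae_eq_of_measure_eq_compProd _ (hF.comp hXGm).aemeasurable ?_
    have h1 : μ.map (fun ω => (e (w (X ω)) (G ω), F (G ω) (X ω)))
        = (μ.map fun ω => (X ω, G ω)).map (fun z => (e (w z.1) z.2, F z.2 z.1)) := by
      rw [Measure.map_map (hB.prodMk hF) hXGm]; rfl
    have h2 : μ.map (fun ω => e (w (X ω)) (G ω))
        = (μ.map fun ω => (X ω, G ω)).map (fun z => e (w z.1) z.2) := by
      rw [Measure.map_map hB hXGm]; rfl
    ext t ht
    have hdir : ∀ x x' : 𝕏, (fun g => Measure.dirac (F g x') (Prod.mk (e (w x) g) ⁻¹' t))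
        = Set.indicator {g | (e (w x) g, F g x') ∈ t} 1 := by
      intro x x'
      ext g
      rw [Measure.dirac_apply' _ (measurable_prodMk_left ht)]
      rfl
    change (μ.map fun ω => (e (w (X ω)) (G ω), F (G ω) (X ω))) t = _
    rw [h1, Measure.map_apply (hB.prodMk hF) ht, hlaw, Measure.compProd_apply ht, h2,
      lintegral_map (Kernel.measurable_kernel_prodMk_left ht) hB, hlaw,
      lintegral_finsetSum_measure, Measure.finsetSum_apply]
    have hr : ∀ x ∈ s, ∫⁻ z, κ (e (w z.1) z.2) (Prod.mk (e (w z.1) z.2) ⁻¹' t)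
        ∂(μ (X ⁻¹' {x}) • (μ.map G).map (Prod.mk x))
        = ENNReal.ofReal (p x * ∑ x' ∈ s, q x' (w x) *
          (μ.map G).real {g | (e (w x') g, F g x') ∈ t}) := by
      intro x hx
      rw [lintegral_smul_measure, lintegral_map ?_ measurable_prodMk_left,
        ENNReal.ofReal_mul (hp0 x), ofReal_measureReal, smul_eq_mul,
        ENNReal.ofReal_sum_of_nonneg fun x' _ => mul_nonneg (hq0 _ _) measureReal_nonneg]
      swap
      · exact (Kernel.measurable_kernel_prodMk_left ht).comp hB
      congr 1
      simp only [hκ, hve, hγe, Measure.finsetSum_apply, Measure.smul_apply, smul_eq_mul]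
      rw [lintegral_finsetSum]
      · refine Finset.sum_congr rfl fun x' _ => ?_
        have hm' : MeasurableSet {g | (e (w x) g, F g x') ∈ t} := ((hex _).prodMk (hFx x')) ht
        rw [ENNReal.ofReal_mul (hq0 _ _), lintegral_const_mul]
        · by_cases hxx : w x' = w x
          · rw [hxx, measureReal_def, ENNReal.ofReal_toReal
              ((measure_lt_top_of_subset (Set.subset_univ _)
                (by rw [Measure.map_apply hG .univ]; exact measure_ne_top _ _)).ne),
              ← lintegral_indicator_one hm', ← hxx, ← hdir, hxx]
          · simp [hq, hxx]
        · rw [hdir]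
          exact measurable_one.indicator hm'
      · intro x' _
        refine Measurable.const_mul ?_ _
        have hm' : MeasurableSet {g | (e (w x) g, F g x') ∈ t} := ((hex _).prodMk (hFx x')) ht
        rw [hdir]
        exact measurable_one.indicator hm'
    rw [Finset.sum_congr rfl hr, ← ENNReal.ofReal_sum_of_nonneg fun x _ =>
      mul_nonneg (hp0 x) (Finset.sum_nonneg fun x' _ => mul_nonneg (hq0 _ _) measureReal_nonneg),
      hswap, ENNReal.ofReal_sum_of_nonneg fun x _ => mul_nonneg (hp0 x) measureReal_nonneg]
    refine Finset.sum_congr rfl fun x hx => ?_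
    have : IsFiniteMeasure (μ.map G) := inferInstance
    rw [ENNReal.ofReal_mul (hp0 x), ofReal_measureReal, ofReal_measureReal, Measure.smul_apply,
      Measure.map_apply measurable_prodMk_left ((hB.prodMk hF) ht)]
    rfl
  unfold condEntropy
  have hκent : ∀ b, entropy (κ b) = -∑ x ∈ s, q x (v b) *
      Real.log (∑ x' ∈ s with F (γ b) x' = F (γ b) x, q x' (v b)) := fun b =>
    entropy_sum_dirac s (fun x => q x (v b)) (fun x _ => hq0 x _) (F (γ b))
  have hentm : Measurable fun b => entropy (κ b) := by
    simp_rw [hκent, Finset.sum_filter]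
    refine (Finset.measurable_sum _ fun x hx => ((hqm x hx).comp hv).mul
      (Real.measurable_log.comp (Finset.measurable_sum _ fun x' hx' => ?_))).neg
    exact Measurable.ite (measurableSet_eq_fun ((hFx x').comp hγ) ((hFx x).comp hγ))
      ((hqm x' hx').comp hv) measurable_const
  have hint : ∀ x, Integrable (fun g => entropy (κ (e (w x) g))) (μ.map G) := by
    intro x
    simp_rw [hκent, hve, hγe]
    refine (integrable_finsetSum _ fun x' _ => Integrable.const_mul ?_ _).neg
    exact integrable_comp_filter s (fun x'' _ => measurableSet_eq_fun (hFx x'') (hFx x'))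
      fun A => Real.log (∑ x'' ∈ A, q x'' (w x))
  have hcm : Measurable fun z : 𝕏 × 𝔾 => entropy (κ (e (w z.1) z.2)) := hentm.comp hB
  have hmapB : μ.map (fun ω => e (w (X ω)) (G ω))
      = (μ.map fun ω => (X ω, G ω)).map (fun z => e (w z.1) z.2) := by
    rw [Measure.map_map hB hXGm]; rfl
  have hcond' : (fun b => entropy (condDistrib (fun ω => F (G ω) (X ω))
      (fun ω => e (w (X ω)) (G ω)) μ b)) =ᵐ[μ.map (fun ω => e (w (X ω)) (G ω))]
      fun b => entropy (κ b) := hcond.fun_comp entropy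
  rw [integral_congr_ae hcond', hmapB,
    integral_map hB.aemeasurable hentm.aestronglyMeasurable, hlaw, integral_finsetSum_measure]
  · have hx : ∀ x ∈ s, ∫ z, entropy (κ (e (w z.1) z.2))
        ∂(μ (X ⁻¹' {x}) • (μ.map G).map (Prod.mk x))
        = ∫ g, p x * entropy (κ (e (w x) g)) ∂(μ.map G) := by
      intro x _
      rw [integral_smul_measure, integral_map measurable_prodMk_left.aemeasurable
        hcm.aestronglyMeasurable, integral_const_mul]
      rfl
    rw [Finset.sum_congr rfl hx, ← integral_finsetSum _ fun x _ => (hint x).const_mul _]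
    refine integral_congr_ae (ae_of_all _ fun g => ?_)
    beta_reduce
    refine Eq.trans ?_ (hswap fun x => Real.log (m (w x)) -
      Real.log (∑ x' ∈ s with F g x' = F g x ∧ w x' = w x, p x'))
    refine Finset.sum_congr rfl fun x hx => ?_
    rw [hκent, hve, hγe, ← Finset.sum_neg_distrib]
    congr 1
    refine Finset.sum_congr rfl fun x' hx' => ?_
    by_cases hxx : w x' = w x
    · have h1 : (∑ x'' ∈ s with F g x'' = F g x', q x'' (w x))
          = (∑ x'' ∈ s with F g x'' = F g x' ∧ w x'' = w x', p x'') / m (w x') := by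
        rw [Finset.sum_div, Finset.sum_filter, Finset.sum_filter]
        refine Finset.sum_congr rfl fun x'' _ => ?_
        by_cases h3 : F g x'' = F g x' <;> by_cases h4 : w x'' = w x <;> simp [h3, h4, hq, hxx]
      have h2 : 0 < ∑ x'' ∈ s with F g x'' = F g x' ∧ w x'' = w x', p x'' :=
        (hpos x' hx').trans_le (Finset.single_le_sum (f := p) (fun y _ => hp0 y)
          (Finset.mem_filter.2 ⟨hx', rfl, rfl⟩))
      rw [h1, Real.log_div h2.ne' (hmpos x' hx').ne']
      change _ = q x' (w x) * (Real.log (m (w x')) - _)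
      ring
    · simp [hq, hxx]
  · intro x _
    refine Integrable.smul_measure ?_ (measure_ne_top _ _)
    rw [integrable_map_measure hcm.aestronglyMeasurable
      measurable_prodMk_left.aemeasurable]
    exact hint x
end Law

/-! ### Entropy differences through collision probabilities. -/

open scoped Classical in
-- In the application `r g x` is the inverse mass of the fibre of `a g` through `x`. For fixed `x`,
-- `x'` the collision event can be integrated out, at the price of the factor `K x x'`. The sums
-- then go back under the integral and are exchanged, so that the bound `M`, uniform in `x'`, is
-- averaged against `p x'`.
lemma integral_collision_le {𝔾 𝕏 V S' : Type*} [MeasurableSpace 𝔾] {ν : Measure 𝔾}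
    [IsProbabilityMeasure ν] {s : Finset 𝕏} {p : 𝕏 → ℝ} (hpos : ∀ x ∈ s, 0 < p x)
    (hsum : ∑ x ∈ s, p x = 1) (w : 𝕏 → V) {r : 𝔾 → 𝕏 → ℝ}
    (hr : ∀ x ∈ s, Integrable (fun g => r g x) ν) {b : 𝔾 → 𝕏 → S'}
    (hb : ∀ x ∈ s, ∀ x' ∈ s, MeasurableSet {g | b g x' = b g x})
    {K : 𝕏 → 𝕏 → ℝ} {M : ℝ}
    (hK : ∀ x ∈ s, ∀ x' ∈ s, w x' = w x →
      ∫ g, Set.indicator {g | b g x' = b g x} (fun g => r g x) g ∂ν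
        ≤ K x x' * ∫ g, r g x ∂ν)
    (hM : ∀ᵐ g ∂ν, ∀ x' ∈ s, ∑ x ∈ s with w x' = w x, p x * (K x x' * r g x) ≤ M) :
    ∫ g, ∑ x ∈ s, ∑ x' ∈ s with w x' = w x, p x * p x' *
      Set.indicator {g | b g x' = b g x} (fun g => r g x) g ∂ν ≤ M := by
  have hind : ∀ x ∈ s, ∀ x' ∈ s, Integrable (fun g => p x * p x' *
      Set.indicator {g | b g x' = b g x} (fun g => r g x) g) ν := fun x hx x' hx' =>
    ((hr x hx).indicator (hb x hx x' hx')).const_mul _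
  have hKr : ∀ x ∈ s, ∀ x', Integrable (fun g => p x * p x' * (K x x' * r g x)) ν :=
    fun x hx x' => ((hr x hx).const_mul _).const_mul _
  have h1 : ∫ g, ∑ x ∈ s, ∑ x' ∈ s with w x' = w x, p x * p x' *
      Set.indicator {g | b g x' = b g x} (fun g => r g x) g ∂ν
      = ∑ x ∈ s, ∑ x' ∈ s with w x' = w x, p x * p x' *
        ∫ g, Set.indicator {g | b g x' = b g x} (fun g => r g x) g ∂ν := by
    rw [integral_finsetSum _ fun x hx => integrable_finsetSum _ fun x' hx' =>
      hind x hx x' (Finset.mem_filter.1 hx').1]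
    refine Finset.sum_congr rfl fun x hx => ?_
    rw [integral_finsetSum _ fun x' hx' => hind x hx x' (Finset.mem_filter.1 hx').1]
    exact Finset.sum_congr rfl fun x' _ => integral_const_mul _ _
  have h2 : ∑ x ∈ s, ∑ x' ∈ s with w x' = w x, p x * p x' * (K x x' * ∫ g, r g x ∂ν)
      = ∫ g, ∑ x ∈ s, ∑ x' ∈ s with w x' = w x, p x * p x' * (K x x' * r g x) ∂ν := by
    rw [integral_finsetSum _ fun x hx => integrable_finsetSum _ fun x' _ => hKr x hx x']
    refine Finset.sum_congr rfl fun x hx => ?_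
    rw [integral_finsetSum _ fun x' _ => hKr x hx x']
    refine Finset.sum_congr rfl fun x' _ => ?_
    rw [integral_const_mul, integral_const_mul]
  rw [h1]
  calc _ ≤ _ := Finset.sum_le_sum fun x hx => Finset.sum_le_sum fun x' hx' =>
        mul_le_mul_of_nonneg_left (hK x hx x' (Finset.mem_filter.1 hx').1
          (Finset.mem_filter.1 hx').2) (mul_pos (hpos x hx)
            (hpos x' (Finset.mem_filter.1 hx').1)).le
    _ = _ := h2
    _ ≤ ∫ _, M ∂ν := by
      refine integral_mono_ae (integrable_finsetSum _ fun x hx => integrable_finsetSum _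
        fun x' _ => hKr x hx x') (integrable_const _) ?_
      filter_upwards [hM] with g hg
      calc _ = ∑ x' ∈ s, p x' * ∑ x ∈ s with w x' = w x, p x * (K x x' * r g x) := by
            simp_rw [Finset.sum_filter, Finset.mul_sum]
            rw [Finset.sum_comm]
            refine Finset.sum_congr rfl fun x' _ => Finset.sum_congr rfl fun x _ => ?_
            split_ifs <;> ring
        _ ≤ ∑ x' ∈ s, p x' * M := Finset.sum_le_sum fun x' hx' =>
            mul_le_mul_of_nonneg_left (hg x' hx') (hpos x' hx').le
        _ = M := by rw [← Finset.sum_mul, hsum, one_mul]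
    _ = M := by simp

/-- Jensen's inequality for the logarithm, in the tangent form log z ≤ z - 1 at z = B / (M A). In
this form `M` need only bound the mean of B / A from above. The common term `c` cancels. -/
lemma integral_sum_log_sub_le {𝔾 𝕏 : Type*} [MeasurableSpace 𝔾] {ν : Measure 𝔾}
    [IsProbabilityMeasure ν] {s : Finset 𝕏} {p : 𝕏 → ℝ} (hpos : ∀ x ∈ s, 0 < p x)
    (hsum : ∑ x ∈ s, p x = 1) (c : 𝕏 → ℝ) {A B : 𝔾 → 𝕏 → ℝ} {M : ℝ} (hM0 : 0 < M)
    (hA : ∀ g, ∀ x ∈ s, 0 < A g x) (hB : ∀ g, ∀ x ∈ s, 0 < B g x)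
    (hiA : ∀ x ∈ s, Integrable (fun g => Real.log (A g x)) ν)
    (hiB : ∀ x ∈ s, Integrable (fun g => Real.log (B g x)) ν)
    (hiBA : Integrable (fun g => ∑ x ∈ s, p x * (B g x * (A g x)⁻¹)) ν)
    (hM : ∫ g, ∑ x ∈ s, p x * (B g x * (A g x)⁻¹) ∂ν ≤ M) :
    ∫ g, ∑ x ∈ s, p x * (c x - Real.log (A g x)) ∂ν
      - ∫ g, ∑ x ∈ s, p x * (c x - Real.log (B g x)) ∂ν ≤ Real.log M := by
  have hia : Integrable (fun g => ∑ x ∈ s, p x * (c x - Real.log (A g x))) ν :=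
    integrable_finsetSum _ fun x hx => ((integrable_const _).sub (hiA x hx)).const_mul _
  have hib : Integrable (fun g => ∑ x ∈ s, p x * (c x - Real.log (B g x))) ν :=
    integrable_finsetSum _ fun x hx => ((integrable_const _).sub (hiB x hx)).const_mul _
  rw [← integral_sub hia hib]
  calc _ ≤ ∫ g, (Real.log M - 1 + M⁻¹ * ∑ x ∈ s, p x * (B g x * (A g x)⁻¹)) ∂ν := by
        refine integral_mono (hia.sub hib) ((integrable_const _).add (hiBA.const_mul _))
          fun g => ?_
        beta_reduce
        rw [← Finset.sum_sub_distrib, Finset.mul_sum,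
          ← one_mul (Real.log M - 1), ← hsum, Finset.sum_mul, ← Finset.sum_add_distrib]
        refine Finset.sum_le_sum fun x hx => ?_
        rw [← mul_sub, mul_left_comm M⁻¹, ← mul_add]
        refine mul_le_mul_of_nonneg_left ?_ (hpos x hx).le
        have hA' := hA g x hx
        have hB' := hB g x hx
        have h := Real.log_le_sub_one_of_pos (x := M⁻¹ * (B g x * (A g x)⁻¹)) (by positivity)
        rw [Real.log_mul (by positivity) (by positivity), Real.log_mul (by positivity)
          (by positivity), Real.log_inv, Real.log_inv] at h
        linarith
    _ = Real.log M - 1 + M⁻¹ * ∫ g, ∑ x ∈ s, p x * (B g x * (A g x)⁻¹) ∂ν := by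
        rw [integral_add (integrable_const _) (hiBA.const_mul _), integral_const_mul]
        simp
    _ ≤ Real.log M - 1 + M⁻¹ * M := by gcongr
    _ = Real.log M := by rw [inv_mul_cancel₀ hM0.ne']; ring

open scoped Classical in
/-- Comparison of the entropies of two randomly chosen functions `a g` and `b g` of a finitely
supported variable, through a bound `K` on the collision probabilities of `b`. -/
theorem integral_entropy_sub_le_log {𝔾 𝕏 V S S' : Type*} [MeasurableSpace 𝔾] {ν : Measure 𝔾}
    [IsProbabilityMeasure ν] {s : Finset 𝕏} {p : 𝕏 → ℝ} (hpos : ∀ x ∈ s, 0 < p x)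
    (hsum : ∑ x ∈ s, p x = 1) (w : 𝕏 → V) {a : 𝔾 → 𝕏 → S} {b : 𝔾 → 𝕏 → S'}
    (ha : ∀ x ∈ s, ∀ x' ∈ s, MeasurableSet {g | a g x' = a g x})
    (hb : ∀ x ∈ s, ∀ x' ∈ s, MeasurableSet {g | b g x' = b g x})
    {K : 𝕏 → 𝕏 → ℝ} {M : ℝ} (hM0 : 0 < M)
    (hK : ∀ x ∈ s, ∀ x' ∈ s, w x' = w x → ∀ r : 𝔾 → ℝ, Measurable r →
      Integrable r ν → (∀ g, 0 ≤ r g) →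
      (∀ g g', a g = a g' → r g = r g') →
      ∫ g, Set.indicator {g | b g x' = b g x} r g ∂ν ≤ K x x' * ∫ g, r g ∂ν)
    (hM : ∀ᵐ g ∂ν, ∀ x' ∈ s, ∑ x ∈ s with w x' = w x,
      p x * (K x x' * (∑ y ∈ s with a g y = a g x ∧ w y = w x, p y)⁻¹) ≤ M) :
    ∫ g, ∑ x ∈ s, p x * (Real.log (∑ x' ∈ s with w x' = w x, p x')
          - Real.log (∑ x' ∈ s with a g x' = a g x ∧ w x' = w x, p x')) ∂ν
      - ∫ g, ∑ x ∈ s, p x * (Real.log (∑ x' ∈ s with w x' = w x, p x')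
          - Real.log (∑ x' ∈ s with b g x' = b g x ∧ w x' = w x, p x')) ∂ν ≤ Real.log M := by
  have haw : ∀ x ∈ s, ∀ x' ∈ s, MeasurableSet {g | a g x' = a g x ∧ w x' = w x} :=
    fun x hx x' hx' => (ha x hx x' hx').inter (MeasurableSet.const _)
  have hbw : ∀ x ∈ s, ∀ x' ∈ s, MeasurableSet {g | b g x' = b g x ∧ w x' = w x} :=
    fun x hx x' hx' => (hb x hx x' hx').inter (MeasurableSet.const _)
  have hmapos : ∀ g, ∀ x ∈ s, 0 < ∑ y ∈ s with a g y = a g x ∧ w y = w x, p y :=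
    fun g x hx => (hpos x hx).trans_le (Finset.single_le_sum
      (fun y hy => (hpos y (Finset.mem_filter.1 hy).1).le)
      (Finset.mem_filter.2 ⟨hx, rfl, rfl⟩))
  have hmbpos : ∀ g, ∀ x ∈ s, 0 < ∑ y ∈ s with b g y = b g x ∧ w y = w x, p y :=
    fun g x hx => (hpos x hx).trans_le (Finset.single_le_sum
      (fun y hy => (hpos y (Finset.mem_filter.1 hy).1).le)
      (Finset.mem_filter.2 ⟨hx, rfl, rfl⟩))
  have hiinv : ∀ x ∈ s, Integrable
      (fun g => (∑ y ∈ s with a g y = a g x ∧ w y = w x, p y)⁻¹) ν := fun x hx =>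
    integrable_comp_filter s (haw x hx) fun A => (∑ y ∈ A, p y)⁻¹
  have hiind : ∀ x ∈ s, ∀ x' ∈ s, Integrable (Set.indicator {g | b g x' = b g x}
      fun g => (∑ y ∈ s with a g y = a g x ∧ w y = w x, p y)⁻¹) ν := fun x hx x' hx' =>
    (hiinv x hx).indicator (hb x hx x' hx')
  have hBA : ∀ g, ∑ x ∈ s, p x * ((∑ y ∈ s with b g y = b g x ∧ w y = w x, p y) *
      (∑ y ∈ s with a g y = a g x ∧ w y = w x, p y)⁻¹)
      = ∑ x ∈ s, ∑ x' ∈ s with w x' = w x, p x * p x' * Set.indicator {g | b g x' = b g x}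
        (fun g => (∑ y ∈ s with a g y = a g x ∧ w y = w x, p y)⁻¹) g := by
    intro g
    refine Finset.sum_congr rfl fun x _ => ?_
    rw [Finset.sum_mul, Finset.mul_sum, Finset.sum_filter,
      Finset.sum_filter (fun x' => w x' = w x)]
    refine Finset.sum_congr rfl fun x' _ => ?_
    by_cases h1 : w x' = w x <;> by_cases h2 : b g x' = b g x <;> simp [h1, h2, mul_assoc]
  refine integral_sum_log_sub_le hpos hsum _ hM0 hmapos hmbpos
    (fun x hx => integrable_comp_filter s (haw x hx) fun A => Real.log (∑ y ∈ A, p y))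
    (fun x hx => integrable_comp_filter s (hbw x hx) fun A => Real.log (∑ y ∈ A, p y)) ?_ ?_
  · simp_rw [hBA]
    exact integrable_finsetSum _ fun x hx => integrable_finsetSum _
      fun x' hx' => (hiind x hx x' (Finset.mem_filter.1 hx').1).const_mul _
  · simp_rw [hBA]
    refine integral_collision_le hpos hsum w hiinv hb (fun x hx x' hx' hww => ?_) hM
    refine hK x hx x' hx' hww _ (measurable_comp_filter s (haw x hx) fun A => (∑ y ∈ A, p y)⁻¹)
      (hiinv x hx) (fun g => (inv_pos.2 (hmapos g x hx)).le) ?_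
    intro g g' hgg
    rw [hgg]

open scoped Classical in
-- Once `K x` is replaced by a function of `a x`, it is constant on the fibres of `a`, where the
-- weights p(x) divided by the fibre mass add up to at most one. Only the values of `a` remain, and
-- the bound no longer depends on `p`.
lemma sum_mul_inv_fiber_le {𝕏 V S : Type*} {s : Finset 𝕏} {p : 𝕏 → ℝ} (hpos : ∀ x ∈ s, 0 < p x)
    (w : 𝕏 → V) (a : 𝕏 → S) {K : 𝕏 → ℝ} {κ : S → ℝ} (c : V)
    (hK : ∀ x ∈ s, c = w x → K x ≤ κ (a x)) (hκ : ∀ y, 0 ≤ κ y) :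
    ∃ Y : Finset S, (∀ y ∈ Y, ∃ x ∈ s, a x = y) ∧
      ∑ x ∈ s with c = w x, p x * (K x * (∑ y ∈ s with a y = a x ∧ w y = w x, p y)⁻¹)
        ≤ ∑ y ∈ Y, κ y := by
  refine ⟨s.image a, fun y hy => Finset.mem_image.1 hy, ?_⟩
  calc _ ≤ ∑ x ∈ s with c = w x,
        p x * (κ (a x) * (∑ y ∈ s with a y = a x ∧ w y = w x, p y)⁻¹) := by
        refine Finset.sum_le_sum fun x hx => ?_
        have hx := Finset.mem_filter.1 hx
        exact mul_le_mul_of_nonneg_left (mul_le_mul_of_nonneg_right (hK x hx.1 hx.2)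
          (inv_nonneg.2 (Finset.sum_nonneg fun y hy => (hpos y (Finset.mem_filter.1 hy).1).le)))
          (hpos x hx.1).le
    _ = ∑ z ∈ s.image a, ∑ x ∈ s with c = w x ∧ a x = z,
        p x * (κ z * (∑ y ∈ s with c = w y ∧ a y = z, p y)⁻¹) := by
        rw [← Finset.sum_fiberwise_of_maps_to (t := s.image a) (g := a)
          (fun x hx => Finset.mem_image_of_mem a (Finset.mem_filter.1 hx).1)]
        refine Finset.sum_congr rfl fun z _ => ?_
        rw [Finset.filter_filter]
        refine Finset.sum_congr rfl fun x hx => ?_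
        obtain ⟨-, h1, h2⟩ := Finset.mem_filter.1 hx
        rw [h2, ← h1]
        congr 4
        refine Finset.filter_congr fun y _ => ?_
        rw [and_comm, eq_comm]
    _ ≤ _ := by
        refine Finset.sum_le_sum fun z _ => ?_
        rw [← Finset.sum_mul]
        set m := ∑ y ∈ s with c = w y ∧ a y = z, p y
        -- The value `z` need not be attained on the part of `s` where `w = c`; the fibre mass is
        -- then zero, and so is the left side.
        by_cases hm : m = 0
        · rw [hm]; simpa using hκ z
        · rw [mul_left_comm, mul_inv_cancel₀ hm, mul_one]

/-! ### Sums over lattice points. -/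

/-- The integers in `ℝ`, the Gaussian integers in `ℂ`. -/
def gaussLattice (𝕜 : Type*) [RCLike 𝕜] : AddSubgroup 𝕜 where
  carrier := {z | ∃ a b : ℤ, z = (a : 𝕜) + (b : 𝕜) * RCLike.I}
  zero_mem' := ⟨0, 0, by simp⟩
  add_mem' := by
    rintro _ _ ⟨a, b, rfl⟩ ⟨a', b', rfl⟩
    exact ⟨a + a', b + b', by push_cast; ring⟩
  neg_mem' := by
    rintro _ ⟨a, b, rfl⟩
    exact ⟨-a, -b, by push_cast; ring⟩

/-- Sums over finite sets of (Gaussian) integers of a decreasing function of the modulus are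
dominated by a power of a sum over the integers. -/
def LatticeSum (𝕜 : Type*) [RCLike 𝕜] (d : ℕ) : Prop :=
  ∀ φ : ℝ → ℝ, (∀ r, 0 ≤ φ r) → AntitoneOn φ (Set.Ici 0) → ∀ (N : ℕ) (F : Finset 𝕜),
    (∀ z ∈ F, z ∈ gaussLattice 𝕜 ∧ ‖z‖ ≤ N) →
      ∑ z ∈ F, φ ‖z‖ ^ d ≤ (∑ m ∈ Finset.Icc (-N : ℤ) N, φ |(m : ℝ)|) ^ d

lemma latticeSum_real : LatticeSum ℝ 1 := by
  intro φ hφ _ N F hF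
  simp only [pow_one]
  have hz : ∀ z ∈ F, z = (⌊z⌋ : ℝ) := by
    intro z hz
    obtain ⟨⟨a, b, h⟩, -⟩ := hF z hz
    simp only [RCLike.I, mul_zero, add_zero] at h
    rw [h]; simp
  calc ∑ z ∈ F, φ ‖z‖ = ∑ z ∈ F, φ |((⌊z⌋ : ℤ) : ℝ)| :=
        Finset.sum_congr rfl fun z h => by rw [Real.norm_eq_abs, ← hz z h]
    _ = ∑ m ∈ F.image (fun z => ⌊z⌋), φ |(m : ℝ)| := by
        rw [Finset.sum_image]
        intro z h z' h' heq
        rw [hz z h, hz z' h']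
        exact congrArg _ heq
    _ ≤ _ := by
        refine Finset.sum_le_sum_of_subset_of_nonneg (fun m hm => ?_) fun _ _ _ => hφ _
        obtain ⟨z, h, rfl⟩ := Finset.mem_image.1 hm
        have := (hF z h).2
        rw [hz z h, Real.norm_eq_abs] at this
        rw [Finset.mem_Icc, ← abs_le]
        exact_mod_cast this

/-- Both coordinates of `z` are at most its modulus, so monotonicity gives φ(|z|)² ≤ φ(|re z|) φ(|im
z|), and the sum over a square factors. This is why the power `d` stands inside the sum in
`LatticeSum`. -/
lemma latticeSum_complex : LatticeSum ℂ 2 := by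
  intro φ hφ hanti N F hF
  have hz : ∀ z ∈ F, z.re = (⌊z.re⌋ : ℝ) ∧ z.im = (⌊z.im⌋ : ℝ) := by
    intro z hz
    obtain ⟨⟨a, b, h⟩, -⟩ := hF z hz
    simp [h]
  calc ∑ z ∈ F, φ ‖z‖ ^ 2
      ≤ ∑ z ∈ F, φ |((⌊z.re⌋ : ℤ) : ℝ)| * φ |((⌊z.im⌋ : ℤ) : ℝ)| := by
        refine Finset.sum_le_sum fun z h => ?_
        rw [← (hz z h).1, ← (hz z h).2, sq]
        exact mul_le_mul
          (hanti (abs_nonneg z.re) (norm_nonneg z) (Complex.abs_re_le_norm z))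
          (hanti (abs_nonneg z.im) (norm_nonneg z) (Complex.abs_im_le_norm z)) (hφ _) (hφ _)
    _ = ∑ m ∈ F.image (fun z => (⌊z.re⌋, ⌊z.im⌋)), φ |(m.1 : ℝ)| * φ |(m.2 : ℝ)| := by
        rw [Finset.sum_image]
        intro z h z' h' heq
        apply Complex.ext
        · rw [(hz z h).1, (hz z' h').1]
          exact congrArg (fun m : ℤ × ℤ => (m.1 : ℝ)) heq
        · rw [(hz z h).2, (hz z' h').2]
          exact congrArg (fun m : ℤ × ℤ => (m.2 : ℝ)) heq
    _ ≤ ∑ m ∈ Finset.Icc (-N : ℤ) N ×ˢ Finset.Icc (-N : ℤ) N,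
        φ |(m.1 : ℝ)| * φ |(m.2 : ℝ)| := by
        refine Finset.sum_le_sum_of_subset_of_nonneg (fun m hm => ?_)
          fun _ _ _ => mul_nonneg (hφ _) (hφ _)
        obtain ⟨z, h, rfl⟩ := Finset.mem_image.1 hm
        have h1 := (Complex.abs_re_le_norm z).trans (hF z h).2
        have h2 := (Complex.abs_im_le_norm z).trans (hF z h).2
        rw [(hz z h).1] at h1
        rw [(hz z h).2] at h2
        rw [Finset.mem_product, Finset.mem_Icc, ← abs_le, Finset.mem_Icc, ← abs_le]
        exact ⟨by exact_mod_cast h1, by exact_mod_cast h2⟩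
    _ = _ := by rw [sq, Finset.sum_mul_sum, Finset.sum_product]

/-- The vector version of `LatticeSum`. -/
lemma LatticeSum.pi {𝕜 : Type*} [RCLike 𝕜] {d : ℕ} (h : LatticeSum 𝕜 d) {φ : ℝ → ℝ}
    (hφ : ∀ r, 0 ≤ φ r) (hanti : AntitoneOn φ (Set.Ici 0)) (N : ℕ) {n : ℕ}
    (Y : Finset (Fin n → 𝕜)) (y₀ : Fin n → 𝕜)
    (hY : ∀ y ∈ Y, ∀ t, y t - y₀ t ∈ gaussLattice 𝕜 ∧
      ‖y t - y₀ t‖ ≤ N) :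
    ∑ y ∈ Y, ∏ t, φ ‖y t - y₀ t‖ ^ d
      ≤ ((∑ m ∈ Finset.Icc (-N : ℤ) N, φ |(m : ℝ)|) ^ d) ^ n := by
  classical
  calc ∑ y ∈ Y, ∏ t, φ ‖y t - y₀ t‖ ^ d
      = ∑ y ∈ Y.image (fun y => y - y₀), ∏ t, φ ‖y t‖ ^ d := by
        rw [Finset.sum_image fun _ _ _ _ h => sub_left_injective h]
        rfl
    -- Enlarging the set of differences to the product of its coordinate projections makes the sum
    -- factor over time.
    _ ≤ ∑ y ∈ Fintype.piFinset fun t => Y.image fun y => y t - y₀ t, ∏ t, φ ‖y t‖ ^ d := by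
        refine Finset.sum_le_sum_of_subset_of_nonneg (fun y hy => ?_)
          fun _ _ _ => Finset.prod_nonneg fun _ _ => pow_nonneg (hφ _) _
        obtain ⟨y, hy', rfl⟩ := Finset.mem_image.1 hy
        exact Fintype.mem_piFinset.2 fun t => Finset.mem_image.2 ⟨y, hy', rfl⟩
    _ = ∏ t, ∑ z ∈ Y.image fun y => y t - y₀ t, φ ‖z‖ ^ d := by rw [Finset.prod_univ_sum]
    _ ≤ ∏ _t : Fin n, (∑ m ∈ Finset.Icc (-N : ℤ) N, φ |(m : ℝ)|) ^ d := by
        refine Finset.prod_le_prod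
          (fun t _ => Finset.sum_nonneg fun _ _ => pow_nonneg (hφ _) _) fun t _ => ?_
        refine h φ hφ hanti N _ fun z hz => ?_
        obtain ⟨y, hy, rfl⟩ := Finset.mem_image.1 hz
        exact hY y hy t
    _ = _ := by simp

/-- The two half-lines are harmonic sums, with 0 counted twice. This logarithm of the range is what
becomes log log P in the error term. -/
lemma sum_Icc_inv_one_add_abs_le (N : ℕ) :
    ∑ m ∈ Finset.Icc (-N : ℤ) N, (1 + |(m : ℝ)|)⁻¹ ≤ 2 * (1 + Real.log (N + 1)) := by
  have hsub : Finset.Icc (-N : ℤ) N ⊆ (Finset.range (N + 1)).image (fun j : ℕ => (j : ℤ)) ∪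
      (Finset.range (N + 1)).image (fun j : ℕ => (-j : ℤ)) := by
    intro m hm
    rw [Finset.mem_Icc] at hm
    simp only [Finset.mem_union, Finset.mem_image, Finset.mem_range]
    rcases le_total 0 m with h | h
    · exact Or.inl ⟨m.toNat, by omega, by omega⟩
    · exact Or.inr ⟨(-m).toNat, by omega, by omega⟩
  have hpos : ∀ m : ℤ, 0 ≤ (1 + |(m : ℝ)|)⁻¹ := fun m => by positivity
  have hharm : ∑ j ∈ Finset.range (N + 1), (1 + (j : ℝ))⁻¹ ≤ 1 + Real.log (N + 1) := by
    have := harmonic_le_one_add_log (N + 1)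
    rw [harmonic] at this
    push_cast at this
    refine le_trans (le_of_eq ?_) this
    exact Finset.sum_congr rfl fun j _ => by rw [add_comm]
  calc _ ≤ _ := Finset.sum_le_sum_of_subset_of_nonneg hsub fun m _ _ => hpos m
    _ ≤ _ := (le_add_of_nonneg_right (Finset.sum_nonneg fun m _ => hpos m)).trans
      (Finset.sum_union_inter).le
    _ = ∑ j ∈ Finset.range (N + 1), (1 + (j : ℝ))⁻¹ +
        ∑ j ∈ Finset.range (N + 1), (1 + (j : ℝ))⁻¹ := by
        rw [Finset.sum_image (by intro a _ b _ h; simpa using h),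
          Finset.sum_image (by intro a _ b _ h; simpa using h)]
        simp
    _ ≤ _ := by linarith

/-! ### Small-ball estimates from the bounded density. -/

/-- Disintegrate along the coordinates in `T`. Given these, `Θ` and the centers are constants, and
the event is a box of volume ∏ 2 r i on which the density is at most fmax ^ |S|. -/
lemma BoundedDensity.lintegral_box_le {Ω ι : Type*} [MeasurableSpace Ω] {μ : Measure Ω}
    [IsProbabilityMeasure μ] {A : ι → Ω → ℝ} {fmax : ℝ} (hf : 0 ≤ fmax)
    (hA : ∀ i, Measurable (A i)) (h : BoundedDensity μ A fmax) {S T : Finset ι}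
    (hST : Disjoint S T) {Θ : (T → ℝ) → ℝ≥0∞} (hΘ : Measurable Θ)
    {ctr : ι → (T → ℝ) → ℝ} (hctr : ∀ i ∈ S, Measurable (ctr i)) (r : ι → ℝ) :
    ∫⁻ ω, Set.indicator {ω | ∀ i ∈ S, |A i ω - ctr i (fun j : T => A j ω)| ≤ r i}
        (fun ω => Θ (fun j : T => A j ω)) ω ∂μ
      ≤ (∏ i ∈ S, ENNReal.ofReal (2 * fmax * r i)) * ∫⁻ ω, Θ (fun j : T => A j ω) ∂μ := by
  set Y : Ω → T → ℝ := fun ω j => A j ω with hY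
  set Z : Ω → S → ℝ := fun ω i => A i ω with hZ
  have hYm : Measurable Y := measurable_pi_lambda _ fun j => hA j
  have hZm : Measurable Z := measurable_pi_lambda _ fun i => hA i
  set E : Set ((T → ℝ) × (S → ℝ)) := {z | ∀ i : S, |z.2 i - ctr i z.1| ≤ r i} with hE
  have hEm : MeasurableSet E := by
    have : E = ⋂ i : S, {z | |z.2 i - ctr i z.1| ≤ r i} := by ext; simp [hE]
    rw [this]
    refine MeasurableSet.iInter fun i => ?_
    have h1 : Measurable fun z : (T → ℝ) × (S → ℝ) => |z.2 i - ctr i z.1| :=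
      (((measurable_pi_apply i).comp measurable_snd).sub
        ((hctr i i.2).comp measurable_fst)).abs
    exact h1 measurableSet_Iic
  have hmeas : Measurable (Set.indicator E fun z => Θ z.1) :=
    (hΘ.comp measurable_fst).indicator hEm
  calc _ = ∫⁻ ω, Set.indicator E (fun z => Θ z.1) (Y ω, Z ω) ∂μ := by
        refine lintegral_congr fun ω => ?_
        by_cases hω : ∀ i ∈ S, |A i ω - ctr i (Y ω)| ≤ r i
        · rw [Set.indicator_of_mem, Set.indicator_of_mem]
          · exact fun i => hω i i.2
          · exact hω
        · rw [Set.indicator_of_notMem, Set.indicator_of_notMem]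
          · exact fun hω' => hω fun i hi => hω' ⟨i, hi⟩
          · exact hω
    _ = ∫⁻ z, Set.indicator E (fun z => Θ z.1) z ∂((μ.map Y) ⊗ₘ condDistrib Z Y μ) := by
        rw [compProd_map_condDistrib hZm.aemeasurable, lintegral_map hmeas (hYm.prodMk hZm)]
    _ = ∫⁻ y, Θ y * condDistrib Z Y μ y (Prod.mk y ⁻¹' E) ∂(μ.map Y) := by
        rw [Measure.lintegral_compProd hmeas]
        refine lintegral_congr fun y => ?_
        rw [← lintegral_indicator_one (measurable_prodMk_left hEm), ← lintegral_const_mul _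
          (measurable_one.indicator (measurable_prodMk_left hEm))]
        refine lintegral_congr fun z => ?_
        by_cases hz : (y, z) ∈ E
        · have hz' : z ∈ Prod.mk y ⁻¹' E := hz
          simp [hz, hz']
        · have hz' : z ∉ Prod.mk y ⁻¹' E := hz
          simp [hz, hz']
    _ ≤ ∫⁻ y, Θ y * ∏ i ∈ S, ENNReal.ofReal (2 * fmax * r i) ∂(μ.map Y) := by
        refine lintegral_mono_ae ?_
        filter_upwards [h S T hST] with y hy
        obtain ⟨f, -, hfb, hfy⟩ := hy
        refine mul_le_mul_right ?_ _
        rw [hfy, withDensity_apply _ (measurable_prodMk_left hEm)]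
        have hbox : Prod.mk y ⁻¹' E
            = Set.univ.pi fun i : S => Set.Icc (ctr i y - r i) (ctr i y + r i) := by
          ext z
          simp only [hE, Set.mem_preimage, Set.mem_ofPred_eq, Set.mem_univ_pi, Set.mem_Icc]
          refine forall_congr' fun i => ?_
          rw [abs_le]
          constructor <;> rintro ⟨h1, h2⟩ <;> constructor <;> linarith
        calc _ ≤ ∫⁻ _ in Prod.mk y ⁻¹' E, ENNReal.ofReal (fmax ^ S.card) := lintegral_mono hfb
          _ = ∏ i ∈ S, ENNReal.ofReal (2 * fmax * r i) := by
            rw [setLIntegral_const, hbox, volume_pi_pi]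
            simp only [Real.volume_Icc]
            rw [Finset.prod_coe_sort S (fun i => ENNReal.ofReal (ctr i y + r i - (ctr i y - r i))),
              ENNReal.ofReal_pow hf, ← Finset.prod_const, ← Finset.prod_mul_distrib]
            refine Finset.prod_congr rfl fun i _ => ?_
            rw [← ENNReal.ofReal_mul hf]
            congr 1; ring
    _ = _ := by
        rw [lintegral_mul_const _ hΘ, lintegral_map hΘ hYm, mul_comm]

/-- The conditional probability that the coefficients `g t k (l t)`, `t ∈ J`, lie in balls whose
centers are functions of the other coefficients is at most `∏ (2 fmax r t) ^ d`; here `Θ` is an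
arbitrary function of the other coefficients. -/
def SmallBall {𝕜 : Type*} [RCLike 𝕜] [MeasurableSpace 𝕜] {K n : ℕ}
    (ν : Measure (Fin n → Fin K → Fin K → 𝕜)) (fmax : ℝ) (d : ℕ) : Prop :=
  ∀ (J : Finset (Fin n)) (k : Fin K) (l : Fin n → Fin K)
    (Θ : (Fin n → Fin K → Fin K → 𝕜) → ℝ≥0∞) (ctr : Fin n → (Fin n → Fin K → Fin K → 𝕜) → 𝕜),
    Measurable Θ → (∀ t, Measurable (ctr t)) →
    (∀ g g', (∀ t i j, ¬(t ∈ J ∧ i = k ∧ j = l t) → g t i j = g' t i j) →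
      Θ g = Θ g' ∧ ∀ t ∈ J, ctr t g = ctr t g') → ∀ r : Fin n → ℝ, (∀ t ∈ J, 0 ≤ r t) →
    ∫⁻ g, Set.indicator {g | ∀ t ∈ J, ‖g t k (l t) - ctr t g‖ ≤ r t} Θ g ∂ν
      ≤ (∏ t ∈ J, ENNReal.ofReal ((2 * fmax * r t) ^ d)) * ∫⁻ g, Θ g ∂ν

lemma smallBall_real {Ω : Type*} [MeasurableSpace Ω] {μ : Measure Ω} [IsProbabilityMeasure μ]
    {K : ℕ} {G : ℕ → Fin K → Fin K → Ω → ℝ} (hG : ∀ t k l, Measurable (G t k l)) {fmax : ℝ}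
    (hf : 0 ≤ fmax) (h : BoundedDensity μ (realCoefficients G) fmax) (n : ℕ) :
    SmallBall (μ.map (channelBlock n G)) fmax 1 := by
  classical
  intro J k l Θ ctr hΘ hctr hind r _
  have hGm : Measurable (channelBlock n G) := measurable_pi_lambda _ fun t =>
    measurable_pi_lambda _ fun i => measurable_pi_lambda _ fun j => hG t i j
  let e : Fin n → ℕ × Fin K × Fin K := fun t => (t, k, l t)
  have he : Function.Injective e := fun t t' htt =>
    Fin.ext (congrArg (fun z : ℕ × Fin K × Fin K => z.1) htt)
  -- Condition on all coefficients of the block except the chosen ones.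
  let T : Finset (ℕ × Fin K × Fin K) :=
    (Finset.univ : Finset (Fin n × Fin K × Fin K)).image (fun z => ((z.1 : ℕ), z.2)) \ J.image e
  have hT : ∀ (t : Fin n) i j, ¬(t ∈ J ∧ i = k ∧ j = l t) → ((t : ℕ), i, j) ∈ T := by
    intro t i j hn
    refine Finset.mem_sdiff.2 ⟨Finset.mem_image.2 ⟨(t, i, j), Finset.mem_univ _, rfl⟩, ?_⟩
    intro hm
    obtain ⟨t', ht', heq⟩ := Finset.mem_image.1 hm
    simp only [e, Prod.mk.injEq] at heq
    obtain rfl : t' = t := Fin.ext heq.1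
    exact hn ⟨ht', heq.2.1.symm, heq.2.2.symm⟩
  -- Rebuilds a block from the conditioning coordinates. The default 0 fills only chosen entries,
  -- which by `hind` affect neither `Θ` nor the centers at times in `J`.
  let ext : (T → ℝ) → Fin n → Fin K → Fin K → ℝ := fun y t i j =>
    if hm : ((t : ℕ), i, j) ∈ T then y ⟨_, hm⟩ else 0
  have hext : Measurable ext := by
    refine measurable_pi_lambda _ fun t => measurable_pi_lambda _ fun i =>
      measurable_pi_lambda _ fun j => ?_
    by_cases hm : ((t : ℕ), i, j) ∈ T
    · simpa only [ext, hm, dite_true] using measurable_pi_apply _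
    · simpa only [ext, hm, dite_false] using measurable_const
  have hagree : ∀ ω, Θ (channelBlock n G ω)
      = Θ (ext fun z : T => realCoefficients G z ω) ∧
      ∀ t ∈ J, ctr t (channelBlock n G ω) = ctr t (ext fun z : T => realCoefficients G z ω) := by
    intro ω
    refine hind _ _ fun t i j hn => ?_
    simp only [ext, hT t i j hn, dite_true]
    rfl
  have hAm : ∀ i, Measurable (realCoefficients G i) := fun i => hG _ _ _
  have hmain := h.lintegral_box_le hf (S := J.image e) (T := T) hAm
    (Finset.disjoint_sdiff) (Θ := fun y => Θ (ext y)) (hΘ.comp hext)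
    (ctr := Function.extend e (fun t y => ctr t (ext y)) 0) (by
      intro i hi
      obtain ⟨t, -, rfl⟩ := Finset.mem_image.1 hi
      rw [he.extend_apply]
      exact (hctr t).comp hext) (Function.extend e r 0)
  rw [Finset.prod_image fun _ _ _ _ h => he h] at hmain
  simp only [he.extend_apply, Finset.forall_mem_image] at hmain
  have hballm : MeasurableSet
      {g : Fin n → Fin K → Fin K → ℝ | ∀ t ∈ J, ‖g t k (l t) - ctr t g‖ ≤ r t} := by
    have : {g : Fin n → Fin K → Fin K → ℝ | ∀ t ∈ J, ‖g t k (l t) - ctr t g‖ ≤ r t}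
        = ⋂ t ∈ J, {g | ‖g t k (l t) - ctr t g‖ ≤ r t} := by ext; simp
    rw [this]
    refine Finset.measurableSet_biInter _ fun t _ => ?_
    have hm : Measurable fun g : Fin n → Fin K → Fin K → ℝ => ‖g t k (l t) - ctr t g‖ :=
      (Measurable.sub (by fun_prop) (hctr t)).norm
    exact hm measurableSet_Iic
  rw [lintegral_map (hΘ.indicator hballm) hGm, lintegral_map hΘ hGm]
  simp only [pow_one]
  convert hmain using 1
  · refine lintegral_congr fun ω => ?_
    obtain ⟨h1, h2⟩ := hagree ω
    by_cases hω : ∀ t ∈ J, ‖channelBlock n G ω t k (l t) - ctr t (channelBlock n G ω)‖ ≤ r t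
    · rw [Set.indicator_of_mem, Set.indicator_of_mem, h1]
      · intro t ht
        rw [← h2 t ht]
        exact hω t ht
      · exact hω
    · rw [Set.indicator_of_notMem, Set.indicator_of_notMem]
      · intro hω'
        refine hω fun t ht => ?_
        rw [h2 t ht]
        exact hω' ht
      · exact hω
  · congr 1
    exact lintegral_congr fun ω => (hagree ω).1

/-- A disc lies in the square with the same center and half-side equal to its radius. Each chosen
coefficient thus contributes two real coordinates to the box, which accounts for the exponent 2. -/
lemma smallBall_complex {Ω : Type*} [MeasurableSpace Ω] {μ : Measure Ω} [IsProbabilityMeasure μ]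
    {K : ℕ} {G : ℕ → Fin K → Fin K → Ω → ℂ} (hG : ∀ t k l, Measurable (G t k l)) {fmax : ℝ}
    (hf : 0 ≤ fmax) (h : BoundedDensity μ (complexCoefficients G) fmax) (n : ℕ) :
    SmallBall (μ.map (channelBlock n G)) fmax 2 := by
  classical
  intro J k l Θ ctr hΘ hctr hind r hr
  have hGm : Measurable (channelBlock n G) := measurable_pi_lambda _ fun t =>
    measurable_pi_lambda _ fun i => measurable_pi_lambda _ fun j => hG t i j
  let e : Fin n ⊕ Fin n → (ℕ × Fin K × Fin K) ⊕ (ℕ × Fin K × Fin K) :=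
    Sum.map (fun t => (t, k, l t)) (fun t => (t, k, l t))
  have he₀ : Function.Injective fun t : Fin n => ((t : ℕ), k, l t) := fun t t' htt =>
    Fin.ext (congrArg (fun z : ℕ × Fin K × Fin K => z.1) htt)
  have he : Function.Injective e := Sum.map_injective.2 ⟨he₀, he₀⟩
  let Z : Finset (ℕ × Fin K × Fin K) :=
    (Finset.univ : Finset (Fin n × Fin K × Fin K)).image (fun z => ((z.1 : ℕ), z.2))
  let T : Finset ((ℕ × Fin K × Fin K) ⊕ (ℕ × Fin K × Fin K)) :=
    Z.disjSum Z \ (J.disjSum J).image e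
  have hZ : ∀ (t : Fin n) i j, ((t : ℕ), i, j) ∈ Z := fun t i j =>
    Finset.mem_image.2 ⟨(t, i, j), Finset.mem_univ _, rfl⟩
  have hT : ∀ (t : Fin n) i j, ¬(t ∈ J ∧ i = k ∧ j = l t) →
      Sum.inl ((t : ℕ), i, j) ∈ T ∧ Sum.inr ((t : ℕ), i, j) ∈ T := by
    intro t i j hn
    constructor
    · refine Finset.mem_sdiff.2 ⟨Finset.inl_mem_disjSum.2 (hZ t i j), fun hm => ?_⟩
      obtain ⟨t' | t', ht', heq⟩ := Finset.mem_image.1 hm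
      · simp only [e, Sum.map_inl, Sum.inl.injEq, Prod.mk.injEq] at heq
        obtain rfl : t' = t := Fin.ext heq.1
        exact hn ⟨Finset.inl_mem_disjSum.1 ht', heq.2.1.symm, heq.2.2.symm⟩
      · simp [e] at heq
    · refine Finset.mem_sdiff.2 ⟨Finset.inr_mem_disjSum.2 (hZ t i j), fun hm => ?_⟩
      obtain ⟨t' | t', ht', heq⟩ := Finset.mem_image.1 hm
      · simp [e] at heq
      · simp only [e, Sum.map_inr, Sum.inr.injEq, Prod.mk.injEq] at heq
        obtain rfl : t' = t := Fin.ext heq.1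
        exact hn ⟨Finset.inr_mem_disjSum.1 ht', heq.2.1.symm, heq.2.2.symm⟩
  let ext : (T → ℝ) → Fin n → Fin K → Fin K → ℂ := fun y t i j =>
    if hm : Sum.inl ((t : ℕ), i, j) ∈ T ∧ Sum.inr ((t : ℕ), i, j) ∈ T then
      (y ⟨_, hm.1⟩ : ℂ) + (y ⟨_, hm.2⟩ : ℂ) * Complex.I else 0
  have hext : Measurable ext := by
    refine measurable_pi_lambda _ fun t => measurable_pi_lambda _ fun i =>
      measurable_pi_lambda _ fun j => ?_
    by_cases hm : Sum.inl ((t : ℕ), i, j) ∈ T ∧ Sum.inr ((t : ℕ), i, j) ∈ T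
    · simp only [ext, hm, and_self, dite_true]
      fun_prop
    · simpa only [ext, hm, dite_false] using measurable_const
  have hagree : ∀ ω, Θ (channelBlock n G ω)
      = Θ (ext fun z : T => complexCoefficients G z ω) ∧
      ∀ t ∈ J, ctr t (channelBlock n G ω)
        = ctr t (ext fun z : T => complexCoefficients G z ω) := by
    intro ω
    refine hind _ _ fun t i j hn => ?_
    have hm := hT t i j hn
    simp only [ext, hm, and_self, dite_true]
    exact (Complex.re_add_im _).symm
  have hAm : ∀ i, Measurable (complexCoefficients G i) := by
    rintro (i | i)
    · exact Complex.measurable_re.comp (hG _ _ _)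
    · exact Complex.measurable_im.comp (hG _ _ _)
  have hmain := h.lintegral_box_le hf (S := (J.disjSum J).image e) (T := T) hAm
    (Finset.disjoint_sdiff) (Θ := fun y => Θ (ext y)) (hΘ.comp hext)
    (ctr := Function.extend e (Sum.elim (fun t y => (ctr t (ext y)).re)
      fun t y => (ctr t (ext y)).im) 0) (by
      intro i hi
      obtain ⟨t | t, -, rfl⟩ := Finset.mem_image.1 hi <;> rw [he.extend_apply]
      · exact Complex.measurable_re.comp ((hctr t).comp hext)
      · exact Complex.measurable_im.comp ((hctr t).comp hext))
    (Function.extend e (Sum.elim r r) 0)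
  rw [Finset.prod_image fun _ _ _ _ h => he h, Finset.prod_disjSum] at hmain
  simp only [he.extend_apply, Finset.forall_mem_image, Sum.elim_inl, Sum.elim_inr] at hmain
  have hballm : MeasurableSet
      {g : Fin n → Fin K → Fin K → ℂ | ∀ t ∈ J, ‖g t k (l t) - ctr t g‖ ≤ r t} := by
    have : {g : Fin n → Fin K → Fin K → ℂ | ∀ t ∈ J, ‖g t k (l t) - ctr t g‖ ≤ r t}
        = ⋂ t ∈ J, {g | ‖g t k (l t) - ctr t g‖ ≤ r t} := by ext; simp
    rw [this]
    refine Finset.measurableSet_biInter _ fun t _ => ?_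
    have hm : Measurable fun g : Fin n → Fin K → Fin K → ℂ => ‖g t k (l t) - ctr t g‖ :=
      (Measurable.sub (by fun_prop) (hctr t)).norm
    exact hm measurableSet_Iic
  rw [lintegral_map (hΘ.indicator hballm) hGm, lintegral_map hΘ hGm]
  refine (lintegral_mono fun ω => ?_).trans (hmain.trans (le_of_eq ?_))
  · obtain ⟨h1, h2⟩ := hagree ω
    by_cases hω : ∀ t ∈ J, ‖channelBlock n G ω t k (l t) - ctr t (channelBlock n G ω)‖ ≤ r t
    · rw [Set.indicator_of_mem, Set.indicator_of_mem, h1]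
      · rintro (t | t) ht
        · have ht := Finset.inl_mem_disjSum.1 ht
          rw [Sum.elim_inl, Sum.elim_inl, ← h2 t ht]
          exact (Complex.abs_re_le_norm _).trans (hω t ht)
        · have ht := Finset.inr_mem_disjSum.1 ht
          rw [Sum.elim_inr, Sum.elim_inr, ← h2 t ht]
          exact (Complex.abs_im_le_norm _).trans (hω t ht)
      · exact hω
    · rw [Set.indicator_of_notMem]
      · exact zero_le
      · exact hω
  · rw [← Finset.prod_mul_distrib]
    congr 1
    · refine Finset.prod_congr rfl fun t ht => ?_
      have : 0 ≤ 2 * fmax * r t := by have := hr t ht; positivity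
      rw [← ENNReal.ofReal_mul this, sq]
    · exact lintegral_congr fun ω => (hagree ω).1.symm

/-! ### Rounding errors and distances between outputs. -/

section Geometry

variable {𝕜 : Type*} [RCLike 𝕜]

lemma norm_intCast_eq_abs (m : ℤ) : ‖(m : 𝕜)‖ = |(m : ℝ)| := by
  rw [← RCLike.ofReal_intCast, RCLike.norm_ofReal]

lemma one_le_norm_of_mem_gaussLattice {z : 𝕜} (hz : z ∈ gaussLattice 𝕜) (h0 : z ≠ 0) :
    1 ≤ ‖z‖ := by
  obtain ⟨a, b, rfl⟩ := hz
  by_cases ha : a = 0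
  · subst ha
    simp only [Int.cast_zero, zero_add, ne_eq, mul_eq_zero, not_or] at h0 ⊢
    rw [norm_mul, RCLike.norm_I_of_ne_zero h0.2, mul_one]
    have hb : b ≠ 0 := fun hb => h0.1 (by simp [hb])
    have h1 : (1 : ℝ) ≤ |(b : ℝ)| := by exact_mod_cast Int.one_le_abs hb
    rwa [norm_intCast_eq_abs]
  · have h1 : (1 : ℝ) ≤ |(a : ℝ)| := by exact_mod_cast Int.one_le_abs ha
    refine h1.trans ?_
    have h2 := RCLike.abs_re_le_norm ((a : 𝕜) + (b : 𝕜) * RCLike.I)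
    simpa [RCLike.mul_re] using h2

lemma norm_intCast_add_mul_I_le (a b : ℤ) :
    ‖(a : 𝕜) + (b : 𝕜) * RCLike.I‖ ≤ |(a : ℝ)| + |(b : ℝ)| := by
  refine (norm_add_le _ _).trans ?_
  rw [norm_mul, norm_intCast_eq_abs, norm_intCast_eq_abs]
  have : ‖(RCLike.I : 𝕜)‖ ≤ 1 := by
    by_cases h : (RCLike.I : 𝕜) = 0
    · simp [h]
    · exact (RCLike.norm_I_of_ne_zero h).le
  gcongr
  exact mul_le_of_le_one_right (abs_nonneg _) this

lemma ceil_mem_gaussLattice (z : 𝕜) : ceil z ∈ gaussLattice 𝕜 := ⟨_, _, rfl⟩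

/-- Rounding up adds an amount in [0, 1) to each coordinate, so a difference errs by at most 1 per
coordinate; the constant 2 serves both settings. -/
lemma norm_ceil_sub_sub_le (z w : 𝕜) : ‖ceil z - ceil w - (z - w)‖ ≤ 2 := by
  have key : ∀ x y : ℝ, |(⌈x⌉ : ℝ) - ⌈y⌉ - (x - y)| ≤ 1 := by
    intro x y
    have h1 := Int.le_ceil x
    have h2 := Int.ceil_lt_add_one x
    have h3 := Int.le_ceil y
    have h4 := Int.ceil_lt_add_one y
    rw [abs_le]
    constructor <;> linarith
  have hI : ‖(RCLike.I : 𝕜)‖ ≤ 1 := by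
    by_cases h : (RCLike.I : 𝕜) = 0
    · simp [h]
    · exact (RCLike.norm_I_of_ne_zero h).le
  have heq : ceil z - ceil w - (z - w)
      = (((⌈RCLike.re z⌉ : ℝ) - ⌈RCLike.re w⌉ - (RCLike.re z - RCLike.re w) : ℝ) : 𝕜)
      + (((⌈RCLike.im z⌉ : ℝ) - ⌈RCLike.im w⌉ - (RCLike.im z - RCLike.im w) : ℝ) : 𝕜)
        * RCLike.I := by
    have hz := (RCLike.re_add_im z).symm
    have hw := (RCLike.re_add_im w).symm
    simp only [ceil]
    push_cast
    linear_combination -hz + hw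
  rw [heq]
  refine (norm_add_le _ _).trans ?_
  rw [norm_mul, RCLike.norm_ofReal, RCLike.norm_ofReal]
  have h1 := key (RCLike.re z) (RCLike.re w)
  have h2 := key (RCLike.im z) (RCLike.im w)
  have h3 := mul_le_mul h2 hI (norm_nonneg _) zero_le_one
  linarith

lemma measurable_ceil [MeasurableSpace 𝕜] [BorelSpace 𝕜] : Measurable (ceil : 𝕜 → 𝕜) := by
  have hcast : Measurable fun m : ℤ => (m : 𝕜) := measurable_from_top
  have hre : Measurable fun z : 𝕜 => RCLike.re z :=
    RCLike.continuous_re.measurable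
  have him : Measurable fun z : 𝕜 => RCLike.im z :=
    RCLike.continuous_im.measurable
  exact (hcast.comp (Int.measurable_ceil.comp hre)).add
    ((hcast.comp (Int.measurable_ceil.comp him)).mul_const _)

lemma inputAlphabet_subset_gaussLattice (P α : ℝ) {x : 𝕜} (hx : x ∈ inputAlphabet 𝕜 P α) :
    x ∈ gaussLattice 𝕜 := by
  obtain ⟨a, b, -, -, -, -, h⟩ := hx
  exact ⟨a, b, h⟩

lemma finite_inputAlphabet (P α : ℝ) : (inputAlphabet 𝕜 P α).Finite := by
  refine Set.Finite.subset (((Set.finite_Icc (0 : ℤ) ⌈(√P) ^ max 1 α⌉).prod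
    (Set.finite_Icc (0 : ℤ) ⌈(√P) ^ max 1 α⌉)).image
    fun m => (m.1 : 𝕜) + (m.2 : 𝕜) * RCLike.I) ?_
  rintro x ⟨a, b, h1, h2, h3, h4, rfl⟩
  exact ⟨(a, b), ⟨⟨h1, h2⟩, h3, h4⟩, rfl⟩

lemma norm_sub_le_of_mem_inputAlphabet {P α : ℝ} (hP : 1 ≤ P) {x y : 𝕜}
    (hx : x ∈ inputAlphabet 𝕜 P α) (hy : y ∈ inputAlphabet 𝕜 P α) :
    ‖x - y‖ ≤ 4 * (√P) ^ max 1 α := by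
  obtain ⟨a, b, h1, h2, h3, h4, rfl⟩ := hx
  obtain ⟨a', b', h1', h2', h3', h4', rfl⟩ := hy
  have hq : (1 : ℝ) ≤ (√P) ^ max 1 α :=
    Real.one_le_rpow (Real.one_le_sqrt.2 hP) (zero_le_one.trans (le_max_left _ _))
  have hc : (⌈(√P) ^ max 1 α⌉ : ℝ) ≤ 2 * (√P) ^ max 1 α := by
    have := Int.ceil_lt_add_one ((√P) ^ max 1 α)
    linarith
  have habs : ∀ m m' : ℤ, 0 ≤ m → m ≤ ⌈(√P) ^ max 1 α⌉ → 0 ≤ m' → m' ≤ ⌈(√P) ^ max 1 α⌉ →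
      |((m - m' : ℤ) : ℝ)| ≤ 2 * (√P) ^ max 1 α := by
    intro m m' h1 h2 h3 h4
    refine le_trans ?_ hc
    have : |m - m'| ≤ ⌈(√P) ^ max 1 α⌉ := by rw [abs_le]; constructor <;> omega
    exact_mod_cast this
  have heq : (a : 𝕜) + (b : 𝕜) * RCLike.I - ((a' : 𝕜) + (b' : 𝕜) * RCLike.I)
      = ((a - a' : ℤ) : 𝕜) + ((b - b' : ℤ) : 𝕜) * RCLike.I := by push_cast; ring
  rw [heq]
  refine (norm_intCast_add_mul_I_le _ _).trans ?_
  have := habs a a' h1 h2 h1' h2'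
  have := habs b b' h3 h4 h3' h4'
  linarith

variable {K n : ℕ}

/-- The power scaling of the link from transmitter `l` to receiver `k`. -/
noncomputable def gain (P α : ℝ) (k l : Fin K) : ℝ :=
  if l = k then (√P) ^ (1 - max 1 α) else (√P) ^ (α - max 1 α)

lemma gain_nonneg (P α : ℝ) (k l : Fin K) : 0 ≤ gain P α k l := by
  unfold gain; split_ifs <;> positivity

lemma gain_le_one {P : ℝ} (hP : 1 ≤ P) (α : ℝ) (k l : Fin K) : gain P α k l ≤ 1 := by
  unfold gain
  split_ifs
  · exact Real.rpow_le_one_of_one_le_of_nonpos (Real.one_le_sqrt.2 hP)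
      (sub_nonpos.2 (le_max_left _ _))
  · exact Real.rpow_le_one_of_one_le_of_nonpos (Real.one_le_sqrt.2 hP)
      (sub_nonpos.2 (le_max_right _ _))

/-- The output as a function of the channel and the inputs. -/
noncomputable def outputAt (P α : ℝ) (k : Fin K) (g : Fin n → Fin K → Fin K → 𝕜) (x : Fin K → Fin n → 𝕜) :
    Fin n → 𝕜 := fun t => ∑ l, ceil ((gain P α k l : 𝕜) * g t k l * x l t)

lemma output_eq_outputAt {Ω : Type*} (P α : ℝ) (G : ℕ → Fin K → Fin K → Ω → 𝕜)
    (X : Fin K → Fin n → Ω → 𝕜) (k : Fin K) :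
    output P α G X k = fun ω => outputAt P α k (channelBlock n G ω) (fun j t => X j t ω) := by
  ext ω t
  simp only [output, outputAt]
  rw [← Finset.sum_erase_add _ _ (Finset.mem_univ k)]
  congr 1
  · refine Finset.sum_congr rfl fun l hl => ?_
    simp only [gain, Finset.ne_of_mem_erase hl, if_false]
    rfl
  · simp only [gain, if_true]
    rfl

lemma measurable_outputAt [MeasurableSpace 𝕜] [BorelSpace 𝕜] (P α : ℝ) (k : Fin K) :
    Measurable fun z : (Fin K → Fin n → 𝕜) × (Fin n → Fin K → Fin K → 𝕜) =>
      outputAt P α k z.2 z.1 := by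
  refine measurable_pi_lambda _ fun t => Finset.measurable_sum _ fun l _ =>
    measurable_ceil.comp ?_
  fun_prop

lemma outputAt_sub_mem (P α : ℝ) (k : Fin K) (g : Fin n → Fin K → Fin K → 𝕜)
    (x x' : Fin K → Fin n → 𝕜) (t : Fin n) :
    outputAt P α k g x t - outputAt P α k g x' t ∈ gaussLattice 𝕜 :=
  sub_mem (sum_mem fun _ _ => ceil_mem_gaussLattice _) (sum_mem fun _ _ => ceil_mem_gaussLattice _)

lemma norm_outputAt_sub_sub_le (P α : ℝ) (k : Fin K) (g : Fin n → Fin K → Fin K → 𝕜)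
    (x x' : Fin K → Fin n → 𝕜) (t : Fin n) :
    ‖outputAt P α k g x t - outputAt P α k g x' t
      - ∑ l, (gain P α k l : 𝕜) * g t k l * (x l t - x' l t)‖ ≤ 2 * K := by
  simp only [outputAt]
  rw [← Finset.sum_sub_distrib, ← Finset.sum_sub_distrib]
  calc _ ≤ ∑ _l : Fin K, (2 : ℝ) := by
        refine norm_sum_le_of_le _ fun l _ => ?_
        rw [mul_sub]
        exact norm_ceil_sub_sub_le _ _
    _ = _ := by simp [mul_comm]

lemma norm_outputAt_sub_le {P : ℝ} (hP : 1 ≤ P) (α : ℝ) {Δ₂ : ℝ} (hΔ : 0 ≤ Δ₂) (k : Fin K)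
    {g : Fin n → Fin K → Fin K → 𝕜} (hg : ∀ t k l, ‖g t k l‖ ≤ Δ₂)
    (x x' : Fin K → Fin n → 𝕜) (t : Fin n) :
    ‖outputAt P α k g x t - outputAt P α k g x' t‖
      ≤ K * (Δ₂ * ‖fun l => x l t - x' l t‖ + 2) := by
  have h1 := norm_outputAt_sub_sub_le P α k g x x' t
  have h2 : ‖∑ l, (gain P α k l : 𝕜) * g t k l * (x l t - x' l t)‖
      ≤ K * (Δ₂ * ‖fun l => x l t - x' l t‖) := by
    calc _ ≤ ∑ _l : Fin K, Δ₂ * ‖fun l => x l t - x' l t‖ := by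
          refine norm_sum_le_of_le _ fun l _ => ?_
          rw [norm_mul, norm_mul, RCLike.norm_ofReal, abs_of_nonneg (gain_nonneg _ _ _ _)]
          refine mul_le_mul ?_ (norm_le_pi_norm (fun l => x l t - x' l t) l) (norm_nonneg _) hΔ
          calc _ ≤ 1 * Δ₂ := mul_le_mul (gain_le_one hP _ _ _) (hg _ _ _) (norm_nonneg _)
                zero_le_one
            _ = Δ₂ := one_mul _
      _ = _ := by simp
  have h3 := norm_le_norm_add_norm_sub (∑ l, (gain P α k l : 𝕜) * g t k l * (x l t - x' l t))
    (outputAt P α k g x t - outputAt P α k g x' t)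
  rw [norm_sub_rev (∑ l, _)] at h3
  linarith

end Geometry

/-! ### The comparison theorem for lattice-valued functions. -/

/-- Discarding the null atoms keeps every fibre mass positive, so that the logarithms and inverses
of the comparison are taken at positive numbers. -/
lemma exists_finset_support {Ω 𝕏 : Type*} [MeasurableSpace Ω] {μ : Measure Ω}
    [IsProbabilityMeasure μ] {X : Ω → 𝕏} {E : Set 𝕏} (hE : E.Finite) (hX : ∀ᵐ ω ∂μ, X ω ∈ E) :
    ∃ s : Finset 𝕏, (∀ x ∈ s, 0 < μ.real (X ⁻¹' {x})) ∧ (∀ x ∈ s, x ∈ E) ∧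
      ∀ᵐ ω ∂μ, X ω ∈ s := by
  classical
  refine ⟨{x ∈ hE.toFinset | 0 < μ.real (X ⁻¹' {x})}, fun x hx => (Finset.mem_filter.1 hx).2,
    fun x hx => hE.mem_toFinset.1 (Finset.mem_filter.1 hx).1, ?_⟩
  have hnull : ∀ᵐ ω ∂μ, ∀ x ∈ hE.toFinset, ¬0 < μ.real (X ⁻¹' {x}) → X ω ≠ x := by
    rw [Finset.eventually_all]
    intro x _
    by_cases h : 0 < μ.real (X ⁻¹' {x})
    · exact ae_of_all _ fun ω h' => absurd h h'
    · have h0 : μ.real (X ⁻¹' {x}) = 0 := le_antisymm (not_lt.1 h) measureReal_nonneg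
      rw [measureReal_eq_zero_iff] at h0
      filter_upwards [measure_eq_zero_iff_ae_notMem.1 h0] with ω hω _
      exact hω
  filter_upwards [hX, hnull] with ω h1 h2
  refine Finset.mem_filter.2 ⟨hE.mem_toFinset.2 h1, ?_⟩
  by_contra h3
  exact h2 _ (hE.mem_toFinset.2 h1) h3 rfl

lemma integral_indicator_le_of_lintegral {𝔾 : Type*} [MeasurableSpace 𝔾] {ν : Measure 𝔾}
    {E : Set 𝔾} (hE : MeasurableSet E) {r : 𝔾 → ℝ} (hr : Integrable r ν) (hr0 : ∀ g, 0 ≤ r g)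
    {C : ℝ} (hC : 0 ≤ C)
    (h : ∫⁻ g, E.indicator (fun g => ENNReal.ofReal (r g)) g ∂ν
      ≤ ENNReal.ofReal C * ∫⁻ g, ENNReal.ofReal (r g) ∂ν) :
    ∫ g, E.indicator r g ∂ν ≤ C * ∫ g, r g ∂ν := by
  rw [integral_eq_lintegral_of_nonneg_ae (ae_of_all _ hr0) hr.aestronglyMeasurable,
    integral_eq_lintegral_of_nonneg_ae (ae_of_all _ fun g => Set.indicator_nonneg
      (fun g _ => hr0 g) g) (hr.indicator hE).aestronglyMeasurable]
  rw [← ENNReal.toReal_ofReal hC, ← ENNReal.toReal_mul]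
  refine ENNReal.toReal_mono (ENNReal.mul_ne_top ENNReal.ofReal_ne_top ?_) ?_
  · rw [← ofReal_integral_eq_lintegral_ofReal hr (ae_of_all _ hr0)]
    exact ENNReal.ofReal_ne_top
  · refine le_trans (le_of_eq (lintegral_congr fun g => ?_)) h
    by_cases hg : g ∈ E <;> simp [hg]

/-- Comparison of the conditional entropies of two lattice-valued functions `a g` and `b g` of the
inputs, given `w` and `g`. -/
theorem condEntropy_sub_le_log {Ω 𝕏 𝔾 V T S 𝕜 : Type*} [MeasurableSpace Ω] [MeasurableSpace 𝕏]
    [MeasurableSpace 𝔾] [MeasurableSingletonClass 𝕏] [MeasurableSpace V]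
    [MeasurableSingletonClass V] [MeasurableSpace T] [MeasurableSpace S] [StandardBorelSpace S]
    [Nonempty S] [RCLike 𝕜] [MeasurableSpace 𝕜] [StandardBorelSpace 𝕜]
    {μ : Measure Ω} [IsProbabilityMeasure μ] {X : Ω → 𝕏} {G : Ω → 𝔾}
    (hX : Measurable X) (hG : Measurable G) (hXG : IndepFun X G μ) {s : Finset 𝕏}
    (hs : ∀ᵐ ω ∂μ, X ω ∈ s) (hpos : ∀ x ∈ s, 0 < μ.real (X ⁻¹' {x}))
    {w : 𝕏 → V} (hw : Measurable w) {e : V → 𝔾 → T} (he : Measurable fun z : V × 𝔾 => e z.1 z.2)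
    {v : T → V} {γ : T → 𝔾} (hv : Measurable v) (hγ : Measurable γ)
    (hve : ∀ a g, v (e a g) = a) (hγe : ∀ a g, γ (e a g) = g) {n : ℕ}
    {a : 𝔾 → 𝕏 → Fin n → 𝕜} (ha : Measurable fun z : 𝕏 × 𝔾 => a z.2 z.1)
    {b : 𝔾 → 𝕏 → S} (hb : Measurable fun z : 𝕏 × 𝔾 => b z.2 z.1)
    {d : ℕ} (hd : LatticeSum 𝕜 d) {φ : ℝ → ℝ} (hφ : ∀ r, 0 ≤ φ r)
    (hanti : AntitoneOn φ (Set.Ici 0)) {N : ℕ} {M : ℝ}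
    (hM : ∑ m ∈ Finset.Icc (-N : ℤ) N, φ |(m : ℝ)| ≤ M) (hM0 : 0 < M)
    (hlat : ∀ g x x' t, a g x t - a g x' t ∈ gaussLattice 𝕜)
    (hN : ∀ᵐ g ∂(μ.map G), ∀ x ∈ s, ∀ x' ∈ s, ∀ t, ‖a g x t - a g x' t‖ ≤ N)
    {C : 𝕏 → 𝕏 → ℝ}
    (hC : ∀ᵐ g ∂(μ.map G), ∀ x ∈ s, ∀ x' ∈ s, w x' = w x →
      C x x' ≤ ∏ t, φ ‖a g x t - a g x' t‖ ^ d)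
    (hcoll : ∀ x ∈ s, ∀ x' ∈ s, w x' = w x → ∀ r : 𝔾 → ℝ, Measurable r →
      Integrable r (μ.map G) → (∀ g, 0 ≤ r g) → (∀ g g', a g = a g' → r g = r g') →
      ∫ g, Set.indicator {g | b g x' = b g x} r g ∂(μ.map G) ≤ C x x' * ∫ g, r g ∂(μ.map G)) :
    condEntropy μ (fun ω => a (G ω) (X ω)) (fun ω => e (w (X ω)) (G ω))
      - condEntropy μ (fun ω => b (G ω) (X ω)) (fun ω => e (w (X ω)) (G ω))
      ≤ n * d * Real.log M := by
  have hax : ∀ x, Measurable fun g => a g x := fun x => ha.comp measurable_prodMk_left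
  have hbx : ∀ x, Measurable fun g => b g x := fun x => hb.comp measurable_prodMk_left
  have hν : IsProbabilityMeasure (μ.map G) := Measure.isProbabilityMeasure_map hG.aemeasurable
  rw [condEntropy_eq_integral hX hG hXG hs hpos hw ha he hv hγ hve hγe,
    condEntropy_eq_integral hX hG hXG hs hpos hw hb he hv hγ hve hγe]
  have hlog : (n : ℝ) * d * Real.log M = Real.log ((M ^ d) ^ n) := by
    rw [Real.log_pow, Real.log_pow]; ring
  rw [hlog]
  refine integral_entropy_sub_le_log hpos (sum_measureReal_singleton hX hs) w
    (fun x _ x' _ => measurableSet_eq_fun (hax x') (hax x))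
    (fun x _ x' _ => measurableSet_eq_fun (hbx x') (hbx x)) (K := C) (by positivity) ?_ ?_
  · exact hcoll
  · filter_upwards [hN, hC] with g hN hC x' hx'
    -- With `x'` fixed, the bound on `C x x'` depends on `x` only through the value of `a g` at `x`,
    -- so it is a function on fibres; the lattice sum is centered at `a g x'`.
    obtain ⟨Y, hY, hle⟩ := sum_mul_inv_fiber_le hpos w (a g) (K := fun x => C x x')
      (κ := fun y => ∏ t, φ ‖y t - a g x' t‖ ^ d) (w x') (fun x hx hww => hC x hx x' hx' hww)
      fun y => Finset.prod_nonneg fun _ _ => pow_nonneg (hφ _) _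
    refine hle.trans ((hd.pi hφ hanti N _ _ ?_).trans ?_)
    · intro y hy t
      obtain ⟨x, hx, rfl⟩ := hY y hy
      exact ⟨hlat _ _ _ _, hN x hx x' hx' t⟩
    · have h0 : 0 ≤ ∑ m ∈ Finset.Icc (-N : ℤ) N, φ |(m : ℝ)| := Finset.sum_nonneg fun _ _ => hφ _
      gcongr

/-! ### Collision probabilities of outputs. -/

section Claims

variable {𝕜 : Type*} [RCLike 𝕜] {K n : ℕ}

open scoped Classical in
/-- Upper bound on the probability that the inputs `x` and `x'` cause the same output. -/
noncomputable def collisionBound (v : ℝ) (d : ℕ) (x x' : Fin K → Fin n → 𝕜) : ℝ :=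
  ∏ t, if 0 < ‖fun l => x l t - x' l t‖ ∧ v ≤ ‖fun l => x l t - x' l t‖ then
    (v / ‖fun l => x l t - x' l t‖) ^ d else 1

lemma collisionBound_nonneg {v : ℝ} (hv : 0 ≤ v) (d : ℕ) (x x' : Fin K → Fin n → 𝕜) :
    0 ≤ collisionBound v d x x' := by
  refine Finset.prod_nonneg fun t _ => ?_
  split_ifs <;> positivity

/-- The index `k` only witnesses that `Fin K` is nonempty. -/
lemma exists_norm_eq_pi_norm {E : Type*} [SeminormedAddGroup E] (k : Fin K) (f : Fin K → E) :
    ∃ l, ‖f l‖ = ‖f‖ := by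
  obtain ⟨l, -, hl⟩ := Finset.exists_max_image Finset.univ (fun l => ‖f l‖)
    ⟨k, Finset.mem_univ k⟩
  exact ⟨l, le_antisymm (norm_le_pi_norm f l)
    ((pi_norm_le_iff_of_nonneg (norm_nonneg _)).2 fun j => hl j (Finset.mem_univ j))⟩

/-- The outputs differ by at most a constant times the input difference D, so a bound decaying in D
also decays in the output difference. Where D is below the threshold `v`, the output difference is
at most K (Δ₂ + 2) v, and the trivial bound 1 suffices. -/
lemma collisionBound_le {P : ℝ} (hP : 1 ≤ P) (α : ℝ) {Δ₂ : ℝ} (hΔ : 0 ≤ Δ₂) (k : Fin K)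
    {g : Fin n → Fin K → Fin K → 𝕜} (hg : ∀ t k l, ‖g t k l‖ ≤ Δ₂) {x x' : Fin K → Fin n → 𝕜}
    (hx : ∀ l t, x l t - x' l t ∈ gaussLattice 𝕜) {v : ℝ} (hv : 0 ≤ v) (d : ℕ) :
    collisionBound v d x x' ≤ ∏ t, ((1 + K * (Δ₂ + 2) * v) /
      (1 + ‖outputAt P α k g x t - outputAt P α k g x' t‖)) ^ d := by
  refine Finset.prod_le_prod (fun t _ => by split_ifs <;> positivity) fun t _ => ?_
  have hout := norm_outputAt_sub_le hP α hΔ k hg x x' t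
  set y := ‖outputAt P α k g x t - outputAt P α k g x' t‖ with hy
  have hy0 : 0 ≤ y := norm_nonneg _
  have hK : (1 : ℝ) ≤ K := by exact_mod_cast Fin.pos k
  -- A nonzero input difference has modulus at least 1 by the lattice structure, which absorbs the
  -- additive rounding error into a multiple of D.
  have hle : 0 < ‖fun l => x l t - x' l t‖ → y ≤ K * (Δ₂ + 2) * ‖fun l => x l t - x' l t‖ := by
    intro hD
    obtain ⟨l, hl⟩ := exists_norm_eq_pi_norm k fun l => x l t - x' l t
    have h1 : 1 ≤ ‖fun l => x l t - x' l t‖ := by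
      rw [← hl] at hD ⊢
      exact one_le_norm_of_mem_gaussLattice (hx l t) (norm_pos_iff.1 hD)
    refine hout.trans ?_
    rw [mul_assoc]
    gcongr
    nlinarith
  have hzero : ‖fun l => x l t - x' l t‖ = 0 → y = 0 := by
    intro h
    have h1 : ∀ l, x l t = x' l t := fun l => by
      have := norm_le_pi_norm (fun l => x l t - x' l t) l
      rw [h] at this
      exact sub_eq_zero.1 (norm_le_zero_iff.1 this)
    simp only [hy, outputAt, h1, sub_self, norm_zero]
  set D := ‖fun l => x l t - x' l t‖ with hD
  have hD0 : 0 ≤ D := norm_nonneg _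
  have hL : 0 < K * (Δ₂ + 2) := by positivity
  set L := K * (Δ₂ + 2) with hLdef
  split_ifs with h
  · obtain ⟨h1, h2⟩ := h
    refine pow_le_pow_left₀ (by positivity) ?_ d
    rw [div_le_div_iff₀ h1 (by positivity)]
    have := hle h1
    nlinarith
  · refine one_le_pow₀ ?_
    rw [one_le_div (by positivity)]
    rcases hD0.eq_or_lt with h1 | h1
    · rw [hzero h1.symm]
      nlinarith [mul_nonneg hL.le hv]
    · have h2 : D ≤ v := le_of_lt (not_le.1 fun h2 => h ⟨h1, h2⟩)
      have := hle h1
      nlinarith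

variable [MeasurableSpace 𝕜] [BorelSpace 𝕜]

lemma measurable_outputAt_left (P α : ℝ) (k : Fin K) (x : Fin K → Fin n → 𝕜) :
    Measurable fun g : Fin n → Fin K → Fin K → 𝕜 => outputAt P α k g x := by
  refine measurable_pi_lambda _ fun t => Finset.measurable_sum _ fun l _ =>
    measurable_ceil.comp ?_
  fun_prop

/-- Equal outputs at receiver `k` make a linear form in the coefficients of row `k` small. Solving
for the coefficient of the largest input difference confines it to a small ball around a function of
the other coefficients. The weight `r` depends only on the output of `k'`, hence only on row `k'`,
so it is a constant under this conditioning. -/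
lemma SmallBall.integral_indicator_le {ν : Measure (Fin n → Fin K → Fin K → 𝕜)}
    {fmax : ℝ} (hf : 0 ≤ fmax) {d : ℕ} (hν : SmallBall ν fmax d) {P : ℝ} (hP : 1 ≤ P) (α : ℝ)
    {k k' : Fin K} (hkk : k ≠ k') {x x' : Fin K → Fin n → 𝕜} (hw : x' k = x k)
    {r : (Fin n → Fin K → Fin K → 𝕜) → ℝ} (hrm : Measurable r) (hri : Integrable r ν)
    (hr0 : ∀ g, 0 ≤ r g)
    (hr : ∀ g g', outputAt P α k' g = outputAt P α k' g' → r g = r g') :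
    ∫ g, Set.indicator {g | outputAt P α k g x' = outputAt P α k g x} r g ∂ν
      ≤ collisionBound (4 * K * fmax / (√P) ^ (α - max 1 α)) d x x' * ∫ g, r g ∂ν := by
  classical
  set c : ℝ := (√P) ^ (α - max 1 α) with hc
  have hc0 : 0 < c := Real.rpow_pos_of_pos (Real.sqrt_pos.2 (by linarith)) _
  set v : ℝ := 4 * K * fmax / c with hv
  have hv0 : 0 ≤ v := by positivity
  choose l hl using fun t => exists_norm_eq_pi_norm k fun l => x l t - x' l t
  -- Only the times at which the estimate is not trivial. The condition 0 < D is not implied by `v ≤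
  -- D` when `v = 0`.
  set J : Finset (Fin n) := {t | 0 < ‖fun l => x l t - x' l t‖ ∧ v ≤ ‖fun l => x l t - x' l t‖}
    with hJ
  have hJD : ∀ t ∈ J, 0 < ‖fun l => x l t - x' l t‖ := fun t ht => (Finset.mem_filter.1 ht).2.1
  -- The input of user `k` is known, so the largest difference sits on a cross link, whose gain is
  -- `c`.
  have hlk : ∀ t ∈ J, l t ≠ k := by
    intro t ht h
    have h1 := hl t
    have h2 := hJD t ht
    beta_reduce at h1
    rw [h, hw, sub_self, norm_zero] at h1
    linarith
  have hgain : ∀ t ∈ J, gain P α k (l t) = c := fun t ht => if_neg (hlk t ht)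
  -- The value of the coefficient at `(t, k, l t)` for which the unrounded outputs coincide.
  set ctr : Fin n → (Fin n → Fin K → Fin K → 𝕜) → 𝕜 := fun t g =>
    -(∑ j ∈ Finset.univ.erase (l t), (gain P α k j : 𝕜) * g t k j * (x j t - x' j t))
      / ((c : 𝕜) * (x (l t) t - x' (l t) t)) with hctr
  have hctrm : ∀ t, Measurable (ctr t) := fun t => by
    refine Measurable.div_const (Finset.measurable_sum _ fun j _ => ?_).neg _
    fun_prop
  refine integral_indicator_le_of_lintegral (measurableSet_eq_fun (measurable_outputAt_left _ _ _ _)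
    (measurable_outputAt_left _ _ _ _)) hri hr0 (collisionBound_nonneg hv0 _ _ _) ?_
  -- The radius is the total rounding error 2 K divided by the factor c D of the coefficient; 2 fmax
  -- times it equals v / D.
  have hmain := hν J k l (fun g => ENNReal.ofReal (r g)) ctr hrm.ennreal_ofReal hctrm ?_
    (fun t => 2 * K / (c * ‖fun l => x l t - x' l t‖)) (fun t _ => by positivity)
  · refine (lintegral_mono fun g => ?_).trans (hmain.trans (le_of_eq ?_))
    · by_cases hg : outputAt P α k g x' = outputAt P α k g x
      · rw [Set.indicator_of_mem, Set.indicator_of_mem]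
        · intro t ht
          have hδ : x (l t) t - x' (l t) t ≠ 0 := by
            rw [← norm_pos_iff, hl t]
            exact hJD t ht
          have hcδ : (c : 𝕜) * (x (l t) t - x' (l t) t) ≠ 0 :=
            mul_ne_zero (RCLike.ofReal_ne_zero.2 hc0.ne') hδ
          -- When the outputs agree, the unrounded linear form consists of rounding error alone.
          have h1 := norm_outputAt_sub_sub_le P α k g x x' t
          rw [hg, sub_self, zero_sub, norm_neg,
            ← Finset.sum_erase_add _ _ (Finset.mem_univ (l t)), hgain t ht] at h1
          have h2 : g t k (l t) - ctr t g = ((∑ j ∈ Finset.univ.erase (l t),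
              (gain P α k j : 𝕜) * g t k j * (x j t - x' j t))
              + (c : 𝕜) * g t k (l t) * (x (l t) t - x' (l t) t))
              / ((c : 𝕜) * (x (l t) t - x' (l t) t)) := by
            simp only [hctr]
            rw [eq_div_iff hcδ, sub_mul, div_mul_cancel₀ _ hcδ]
            ring
          rw [h2, norm_div, norm_mul (c : 𝕜), RCLike.norm_ofReal, abs_of_pos hc0, hl t]
          have := hJD t ht
          gcongr
        · exact hg
      · rw [Set.indicator_of_notMem]
        · exact zero_le
        · exact hg
    · congr 1
      rw [← ENNReal.ofReal_prod_of_nonneg fun t _ => by positivity]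
      congr 1
      simp only [collisionBound]
      rw [Finset.prod_ite, Finset.prod_const_one, mul_one]
      refine Finset.prod_congr rfl fun t ht => ?_
      congr 1
      rw [hv]
      have := (hJD t ht).ne'
      field_simp
      ring
  · intro g g' hgg
    have hne : ∀ t i j, ¬(i = k ∧ j = l t) → g t i j = g' t i j := fun t i j h =>
      hgg t i j fun h' => h h'.2
    constructor
    · rw [hr g g']
      funext x t
      simp only [outputAt]
      refine Finset.sum_congr rfl fun j _ => ?_
      rw [hne t k' j fun h => hkk h.1.symm]
    · intro t _
      simp only [hctr]
      congr 2
      refine Finset.sum_congr rfl fun j hj => ?_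
      rw [hne t k j fun h => Finset.ne_of_mem_erase hj h.2]

end Claims

/-! ### The two comparisons of outputs. -/

lemma sum_Icc_indicator_le {R : ℝ} (hR : 0 ≤ R) (N : ℕ) :
    ∑ m ∈ Finset.Icc (-N : ℤ) N, (if |(m : ℝ)| ≤ R then (1 : ℝ) else 0) ≤ 2 * R + 1 := by
  rw [Finset.sum_boole]
  have hsub : {m ∈ (Finset.Icc (-N : ℤ) N : Finset ℤ) | |((m : ℤ) : ℝ)| ≤ R} ⊆ Finset.Icc (-⌊R⌋) ⌊R⌋ := by
    intro m hm
    have h := (Finset.mem_filter.1 hm).2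
    rw [Finset.mem_Icc, ← abs_le, Int.le_floor]
    exact_mod_cast h
  have h1 := Finset.card_le_card hsub
  have h0 : 0 ≤ ⌊R⌋ := Int.floor_nonneg.2 hR
  rw [Int.card_Icc] at h1
  generalize {m ∈ (Finset.Icc (-N : ℤ) N : Finset ℤ) | |((m : ℤ) : ℝ)| ≤ R}.card = c at h1 ⊢
  have h2 : (c : ℤ) ≤ 2 * ⌊R⌋ + 1 := by omega
  have h2 : (c : ℝ) ≤ 2 * ⌊R⌋ + 1 := by exact_mod_cast h2
  have h3 := Int.floor_le R
  linarith

/-- On a cross link the gain (√P)^(α - max 1 α) times the alphabet diameter 4 (√P)^(max 1 α) leaves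
(√P)^α. The direct link has gain at most 1 and contributes only Δ₂ ρ. Since α ≥ 0, the bounded terms
are absorbed into (√P)^α. -/
lemma norm_outputAt_sub_le_of_norm_sub_le {𝕜 : Type*} [RCLike 𝕜] {K n : ℕ} {P α Δ₂ : ℝ}
    (hP : 1 ≤ P) (hα : 0 ≤ α) (hΔ₂ : 0 ≤ Δ₂) (k : Fin K)
    {g : Fin n → Fin K → Fin K → 𝕜} (hg : ∀ t k l, ‖g t k l‖ ≤ Δ₂) {x x' : Fin K → Fin n → 𝕜}
    (hx : ∀ j t, x j t ∈ inputAlphabet 𝕜 P α) (hx' : ∀ j t, x' j t ∈ inputAlphabet 𝕜 P α)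
    {ρ : ℝ} (hρ : 0 ≤ ρ) (t : Fin n) (hk : ‖x k t - x' k t‖ ≤ ρ) :
    ‖outputAt P α k g x t - outputAt P α k g x' t‖
      ≤ (4 * K * Δ₂ + 2 * K + Δ₂ * ρ) * (√P) ^ α := by
  have hq : 1 ≤ √P := Real.one_le_sqrt.2 hP
  have hqα : 1 ≤ (√P) ^ α := Real.one_le_rpow hq hα
  have hterm : ∀ l, ‖(gain P α k l : 𝕜) * g t k l * (x l t - x' l t)‖
      ≤ 4 * Δ₂ * (√P) ^ α + if l = k then Δ₂ * ρ else 0 := by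
    intro l
    rw [norm_mul, norm_mul, RCLike.norm_ofReal, abs_of_nonneg (gain_nonneg _ _ _ _)]
    split_ifs with h
    · subst h
      have h1 : gain P α l l * ‖g t l l‖ ≤ 1 * Δ₂ :=
        mul_le_mul (gain_le_one hP _ _ _) (hg _ _ _) (norm_nonneg _) zero_le_one
      have h2 := mul_le_mul h1 hk (norm_nonneg _) (by positivity)
      have : 0 ≤ 4 * Δ₂ * (√P) ^ α := by positivity
      linarith
    · have hgain : gain P α k l = (√P) ^ (α - max 1 α) := if_neg h
      have h1 := norm_sub_le_of_mem_inputAlphabet hP (hx l t) (hx' l t)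
      rw [add_zero, hgain]
      calc _ ≤ (√P) ^ (α - max 1 α) * Δ₂ * (4 * (√P) ^ max 1 α) := by
            gcongr; exact hg _ _ _
        _ = 4 * Δ₂ * ((√P) ^ (α - max 1 α) * (√P) ^ max 1 α) := by ring
        _ = _ := by rw [← Real.rpow_add (by linarith), sub_add_cancel]
  have h1 := norm_outputAt_sub_sub_le P α k g x x' t
  have h2 : ‖∑ l, (gain P α k l : 𝕜) * g t k l * (x l t - x' l t)‖
      ≤ K * (4 * Δ₂ * (√P) ^ α) + Δ₂ * ρ := by
    refine (norm_sum_le_of_le _ fun l _ => hterm l).trans (le_of_eq ?_)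
    rw [Finset.sum_add_distrib]
    simp
  have h3 := norm_le_norm_add_norm_sub (∑ l, (gain P α k l : 𝕜) * g t k l * (x l t - x' l t))
    (outputAt P α k g x t - outputAt P α k g x' t)
  rw [norm_sub_rev (∑ l, _)] at h3
  have h4 : (2 * K + Δ₂ * ρ) * 1 ≤ (2 * K + Δ₂ * ρ) * (√P) ^ α := by gcongr
  linarith

section Comparison

variable {𝕜 : Type*} [RCLike 𝕜] [MeasurableSpace 𝕜] {K n : ℕ} {Ω : Type*}
  [MeasurableSpace Ω] {μ : Measure Ω} {G : ℕ → Fin K → Fin K → Ω → 𝕜}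
  {X : Fin K → Fin n → Ω → 𝕜} {P α Δ₁ Δ₂ : ℝ}

lemma IsChannel.measurable_channelBlock (hG : IsChannel μ Δ₁ Δ₂ G) (n : ℕ) :
    Measurable (channelBlock n G) :=
  measurable_pi_lambda _ fun t => measurable_pi_lambda _ fun i => measurable_pi_lambda _ fun j =>
    hG.measurable t i j

lemma IsInput.measurable_inputs (hX : IsInput μ P α G X) :
    Measurable fun ω => (fun j t => X j t ω : Fin K → Fin n → 𝕜) :=
  measurable_pi_lambda _ fun j => measurable_pi_lambda _ fun t => hX.measurable j t

lemma IsInput.indepFun_channelBlock (hX : IsInput μ P α G X) :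
    IndepFun (fun ω => (fun j t => X j t ω : Fin K → Fin n → 𝕜)) (channelBlock n G) μ := by
  have hm : Measurable fun g : ℕ → Fin K → Fin K → 𝕜 => fun t : Fin n => g t :=
    measurable_pi_lambda _ fun t => measurable_pi_apply _
  exact hX.indep.comp measurable_id hm

lemma IsInput.exists_support [IsProbabilityMeasure μ] (hX : IsInput μ P α G X) :
    ∃ s : Finset (Fin K → Fin n → 𝕜),
      (∀ x ∈ s, 0 < μ.real ((fun ω => (fun j t => X j t ω : Fin K → Fin n → 𝕜)) ⁻¹' {x})) ∧
      (∀ x ∈ s, ∀ j t, x j t ∈ inputAlphabet 𝕜 P α) ∧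
      ∀ᵐ ω ∂μ, (fun j t => X j t ω : Fin K → Fin n → 𝕜) ∈ s := by
  have hE : {x : Fin K → Fin n → 𝕜 | ∀ j, x j ∈ {y : Fin n → 𝕜 | ∀ t, y t ∈
      inputAlphabet 𝕜 P α}}.Finite :=
    Set.Finite.pi' fun _ => Set.Finite.pi' fun _ => finite_inputAlphabet P α
  refine exists_finset_support hE ?_
  have h := ae_all_iff.2 fun j => ae_all_iff.2 fun t => hX.mem_alphabet j t
  filter_upwards [h] with ω hω
  exact hω

variable [BorelSpace 𝕜]

lemma IsChannel.ae_map_bounded (hG : IsChannel μ Δ₁ Δ₂ G) (n : ℕ) :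
    ∀ᵐ g ∂(μ.map (channelBlock n G)), ∀ t k l, Δ₁ ≤ ‖g t k l‖ ∧ ‖g t k l‖ ≤ Δ₂ := by
  refine ae_all_iff.2 fun t => ae_all_iff.2 fun k => ae_all_iff.2 fun l => ?_
  have hm : Measurable fun g : Fin n → Fin K → Fin K → 𝕜 => ‖g t k l‖ := by fun_prop
  exact (ae_map_iff (hG.measurable_channelBlock n).aemeasurable (hm measurableSet_Icc)).2
    (hG.bounded t k l)

variable [StandardBorelSpace 𝕜] [IsProbabilityMeasure μ] {d : ℕ}

/-- The output of receiver `k`, compared with a variable that determines `X k` up to a bounded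
error. -/
theorem condEntropy_output_sub_le (hP : 1 ≤ P) (hα : 0 ≤ α) (hΔ₁ : 0 < Δ₁) (hΔ : Δ₁ ≤ Δ₂)
    (hG : IsChannel μ Δ₁ Δ₂ G) (hX : IsInput μ P α G X) (hd : LatticeSum 𝕜 d) (k : Fin K)
    {b : (Fin n → Fin K → Fin K → 𝕜) → (Fin K → Fin n → 𝕜) → Fin n → 𝕜}
    (hbm : Measurable fun z : (Fin K → Fin n → 𝕜) × (Fin n → Fin K → Fin K → 𝕜) => b z.2 z.1)
    (hb : ∀ g x x', (∀ t i j, Δ₁ ≤ ‖g t i j‖) → b g x = b g x' →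
      ∀ t, ‖x k t - x' k t‖ ≤ 2 / Δ₁) :
    condEntropy μ (output P α G X k) (channelBlock n G)
      - condEntropy μ (fun ω => b (channelBlock n G ω) fun j t => X j t ω) (channelBlock n G)
      ≤ n * d * Real.log ((2 * (4 * K * Δ₂ + 2 * K + Δ₂ * (2 / Δ₁)) + 1) * (√P) ^ α) := by
  classical
  obtain ⟨s, hpos, hsα, hs⟩ := hX.exists_support
  have hΔ₂ : 0 < Δ₂ := hΔ₁.trans_le hΔ
  have hq : 1 ≤ √P := Real.one_le_sqrt.2 hP
  have hqα : 1 ≤ (√P) ^ α := Real.one_le_rpow hq hα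
  set R : ℝ := (4 * K * Δ₂ + 2 * K + Δ₂ * (2 / Δ₁)) * (√P) ^ α with hR
  have hR0 : 0 ≤ R := by positivity
  have hbd := hG.ae_map_bounded n
  have hbx : ∀ x, Measurable fun g => b g x := fun x => hbm.comp measurable_prodMk_left
  rw [output_eq_outputAt]
  -- No input is conditioned on, so `w` is trivial. The collision bound is the 0-1 indicator of
  -- inputs of user `k` within 2 / Δ₁, and φ is the indicator of output differences up to `R`. The
  -- size of `N` is irrelevant, since the sum of this φ is bounded independently of it.
  refine condEntropy_sub_le_log (a := outputAt P α k) (b := b) hX.measurable_inputs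
    (hG.measurable_channelBlock n)
    hX.indepFun_channelBlock hs hpos (w := fun _ => ()) measurable_const (e := fun _ g => g)
    measurable_snd (v := fun _ => ()) (γ := id) measurable_const measurable_id
    (fun _ _ => rfl) (fun _ _ => rfl) (measurable_outputAt P α k) hbm hd
    (φ := fun r => if r ≤ R then 1 else 0) (fun r => by split_ifs <;> simp) ?_
    (N := ⌈K * (Δ₂ * (4 * (√P) ^ max 1 α) + 2)⌉₊) ?_ (by positivity)
    (fun g x x' t => outputAt_sub_mem P α k g x x' t) ?_
    (C := fun x x' => if ∀ t, ‖x k t - x' k t‖ ≤ 2 / Δ₁ then 1 else 0) ?_ ?_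
  · intro r _ r' _ hrr
    beta_reduce
    split_ifs with h1 h2 h2
    · exact le_rfl
    · exact absurd (hrr.trans h1) h2
    · exact zero_le_one
    · exact le_rfl
  · refine (sum_Icc_indicator_le hR0 _).trans ?_
    rw [hR]
    linarith
  · filter_upwards [hbd] with g hg x hx x' hx' t
    refine le_trans ?_ (Nat.le_ceil _)
    refine (norm_outputAt_sub_le hP α hΔ₂.le k (fun t i j => (hg t i j).2) x x' t).trans ?_
    gcongr
    exact (pi_norm_le_iff_of_nonneg (by positivity)).2 fun l =>
      norm_sub_le_of_mem_inputAlphabet hP (hsα x hx l t) (hsα x' hx' l t)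
  · filter_upwards [hbd] with g hg x hx x' hx' _
    split_ifs with h
    · refine (Finset.prod_eq_one fun t _ => ?_).ge
      rw [if_pos, one_pow]
      exact norm_outputAt_sub_le_of_norm_sub_le hP hα hΔ₂.le k (fun t i j => (hg t i j).2)
        (hsα x hx) (hsα x' hx') (by positivity) t (h t)
    · exact Finset.prod_nonneg fun t _ => by split_ifs <;> positivity
  -- No averaging is needed here: for almost every channel, a collision already forces the indicator
  -- to be 1.
  · intro x _ x' _ _ r hrm hri hr0 _
    rw [← integral_const_mul]
    refine integral_mono_ae (hri.indicator (measurableSet_eq_fun (hbx x') (hbx x)))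
      (hri.const_mul _) ?_
    filter_upwards [hbd] with g hg
    by_cases hbb : b g x' = b g x
    · have h := hb g x x' (fun t i j => (hg t i j).1) hbb.symm
      rw [Set.indicator_of_mem, if_pos h, one_mul]
      exact hbb
    · rw [Set.indicator_of_notMem]
      · refine mul_nonneg ?_ (hr0 g)
        split_ifs <;> norm_num
      · exact hbb

/-- The outputs of two receivers, given inputs that include the one of the second receiver. -/
theorem condEntropy_output_sub_output_le (hP : 1 ≤ P) (hΔ₂ : 0 ≤ Δ₂) {fmax : ℝ} (hf : 0 ≤ fmax)
    (hG : IsChannel μ Δ₁ Δ₂ G) (hX : IsInput μ P α G X) (hd : LatticeSum 𝕜 d)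
    (hball : SmallBall (μ.map (channelBlock n G)) fmax d) {k k' : Fin K} (hkk : k ≠ k')
    {j : ℕ} (hkj : (k : ℕ) ≤ j) :
    condEntropy μ (output P α G X k') (fun ω => (inputsUpTo j X ω, channelBlock n G ω))
      - condEntropy μ (output P α G X k) (fun ω => (inputsUpTo j X ω, channelBlock n G ω))
      ≤ n * d * Real.log ((1 + K * (Δ₂ + 2) * (4 * K * fmax / (√P) ^ (α - max 1 α))) *
        (2 * (1 + Real.log (4 * (K * (Δ₂ + 2)) * (√P) ^ max 1 α + 2)))) := by
  obtain ⟨s, hpos, hsα, hs⟩ := hX.exists_support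
  have hq : 1 ≤ √P := Real.one_le_sqrt.2 hP
  have hqe : 1 ≤ (√P) ^ max 1 α := Real.one_le_rpow hq (zero_le_one.trans (le_max_left _ _))
  set v : ℝ := 4 * K * fmax / (√P) ^ (α - max 1 α) with hv
  have hv0 : 0 ≤ v := by positivity
  set L : ℝ := K * (Δ₂ + 2) with hL
  have hL0 : 0 ≤ L := by positivity
  have hlog : 0 ≤ Real.log (4 * L * (√P) ^ max 1 α + 2) := by
    refine Real.log_nonneg ?_
    have : 0 ≤ 4 * L * (√P) ^ max 1 α := by positivity
    linarith
  have hbd := hG.ae_map_bounded n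
  rw [output_eq_outputAt, output_eq_outputAt]
  -- Here `w` reveals the inputs of users up to `j`, in particular that of user `k`. The range `N`
  -- enters the sum of φ only through its logarithm.
  refine condEntropy_sub_le_log (a := outputAt P α k') (b := outputAt P α k)
    hX.measurable_inputs (hG.measurable_channelBlock n)
    hX.indepFun_channelBlock hs hpos
    (w := fun x => (fun i t => x i t : {i : Fin K // (i : ℕ) ≤ j} → Fin n → 𝕜)) (by fun_prop)
    (e := Prod.mk) measurable_id (v := Prod.fst) (γ := Prod.snd) measurable_fst measurable_snd
    (fun _ _ => rfl) (fun _ _ => rfl) (measurable_outputAt P α k') (measurable_outputAt P α k) hd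
    (φ := fun r => (1 + L * v) / (1 + |r|)) (fun r => by positivity) ?_
    (N := ⌈4 * L * (√P) ^ max 1 α⌉₊) ?_ (by positivity)
    (fun g x x' t => outputAt_sub_mem P α k' g x x' t) ?_ (C := collisionBound v d) ?_ ?_
  · intro r hr r' hr' hrr
    beta_reduce
    have hr : (0 : ℝ) ≤ r := hr
    have hr' : (0 : ℝ) ≤ r' := hr'
    rw [abs_of_nonneg hr, abs_of_nonneg hr']
    gcongr
  · simp_rw [abs_abs, div_eq_mul_inv, ← Finset.mul_sum]
    refine mul_le_mul_of_nonneg_left ((sum_Icc_inv_one_add_abs_le _).trans ?_) (by positivity)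
    have := Nat.ceil_lt_add_one (a := 4 * L * (√P) ^ max 1 α) (by positivity)
    have := Real.log_le_log (x := (⌈4 * L * (√P) ^ max 1 α⌉₊ : ℝ) + 1)
      (y := 4 * L * (√P) ^ max 1 α + 2) (by positivity) (by linarith)
    linarith
  · filter_upwards [hbd] with g hg x hx x' hx' t
    refine le_trans ?_ (Nat.le_ceil _)
    refine (norm_outputAt_sub_le hP α hΔ₂ k' (fun t i j => (hg t i j).2) x x' t).trans ?_
    have h1 : ‖fun l => x l t - x' l t‖ ≤ 4 * (√P) ^ max 1 α :=
      (pi_norm_le_iff_of_nonneg (by positivity)).2 fun l =>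
        norm_sub_le_of_mem_inputAlphabet hP (hsα x hx l t) (hsα x' hx' l t)
    calc _ ≤ K * (Δ₂ * (4 * (√P) ^ max 1 α) + 2 * (4 * (√P) ^ max 1 α)) := by
          gcongr
          linarith
      _ = _ := by rw [hL]; ring
  · filter_upwards [hbd] with g hg x hx x' hx' _
    simp only [abs_norm]
    exact collisionBound_le hP α hΔ₂ k' (fun t i j => (hg t i j).2) (fun l t =>
      sub_mem (inputAlphabet_subset_gaussLattice P α (hsα x hx l t))
        (inputAlphabet_subset_gaussLattice P α (hsα x' hx' l t))) hv0 d
  · intro x _ x' _ hww r hrm hri hr0 hr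
    exact hball.integral_indicator_le hf hP α hkk (congrFun hww ⟨k, hkj⟩) hrm hri hr0 hr

end Comparison

/-! ### The error term and the power of P. -/

/-- The error term: constants of the comparison theorems, plus an iterated logarithm. -/
noncomputable def errorTerm (K : ℕ) (α Δ₁ Δ₂ fmax P : ℝ) : ℝ :=
  2 * (Real.log (2 * (4 * K * Δ₂ + 2 * K + Δ₂ * (2 / Δ₁)) + 1) +
    Real.log (1 + K * (Δ₂ + 2) * (4 * K * fmax)) +
    Real.log (2 * (1 + Real.log (4 * (K * (Δ₂ + 2)) + 2) + max 1 α / 2 * Real.log P)))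

/-- The only nonconstant part is the logarithm of an affine function of log P, and log y = o(y). -/
lemma isLittleO_errorTerm (K : ℕ) (α Δ₁ Δ₂ fmax : ℝ) :
    errorTerm K α Δ₁ Δ₂ fmax =o[atTop] Real.log := by
  have hconst : ∀ c : ℝ, (fun _ => c) =o[atTop] Real.log := fun c => Real.isLittleO_const_log_atTop
  have he : 0 < max 1 α / 2 := by positivity
  have htend : Tendsto (fun P => 2 * (1 + Real.log (4 * (K * (Δ₂ + 2)) + 2) +
      max 1 α / 2 * Real.log P)) atTop atTop :=
    (tendsto_atTop_add_const_left _ _ (Real.tendsto_log_atTop.const_mul_atTop he)).const_mul_atTop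
      two_pos
  have hO : (fun P => 2 * (1 + Real.log (4 * (K * (Δ₂ + 2)) + 2) +
      max 1 α / 2 * Real.log P)) =O[atTop] Real.log :=
    ((hconst _).isBigO.add ((isBigO_refl _ _).const_mul_left _)).const_mul_left _
  exact (((hconst _).add (hconst _)).add
    ((Real.isLittleO_log_id_atTop.comp_tendsto htend).trans_isBigO hO)).const_mul_left 2

section

variable {𝕜 : Type*} [RCLike 𝕜] [MeasurableSpace 𝕜] [BorelSpace 𝕜] [StandardBorelSpace 𝕜]
  {K n : ℕ} {Ω : Type*} [MeasurableSpace Ω] {μ : Measure Ω} [IsProbabilityMeasure μ]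
  {G : ℕ → Fin K → Fin K → Ω → 𝕜} {X : Fin K → Fin n → Ω → 𝕜} {P α Δ₁ Δ₂ : ℝ} {d : ℕ}

lemma log_mul_sqrt_rpow (hP : 1 ≤ P) {A β : ℝ} (hA : 1 ≤ A) :
    Real.log (A * (√P) ^ β) = Real.log A + β / 2 * Real.log P := by
  have hq : 0 < √P := Real.sqrt_pos.2 (by linarith)
  rw [Real.log_mul (by linarith) (Real.rpow_pos_of_pos hq _).ne', Real.log_rpow hq,
    Real.log_sqrt (by linarith)]
  ring

theorem condEntropy_output_sub_le_errorTerm (hP : 1 ≤ P) (hα : 0 ≤ α) (hΔ₁ : 0 < Δ₁)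
    (hΔ : Δ₁ ≤ Δ₂) {fmax : ℝ} (hf : 0 ≤ fmax)
    (hG : IsChannel μ Δ₁ Δ₂ G) (hX : IsInput μ P α G X) (hd : LatticeSum 𝕜 d) (hd2 : d ≤ 2)
    {C : ℝ} (hC : d / 2 * Real.log P ≤ C) (k l : Fin K) :
    condEntropy μ (output P α G X k) (channelBlock n G)
        - condEntropy μ (scaledInput G X l k) (channelBlock n G)
      ≤ n * α * C + n * errorTerm K α Δ₁ Δ₂ fmax P ∧
    condEntropy μ (output P α G X k) (channelBlock n G)
        - condEntropy μ (roundedScaledInput G X l k) (channelBlock n G)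
      ≤ n * α * C + n * errorTerm K α Δ₁ Δ₂ fmax P := by
  have hΔ₂ : 0 < Δ₂ := hΔ₁.trans_le hΔ
  have hlogP : 0 ≤ Real.log P := Real.log_nonneg hP
  have hd2' : (d : ℝ) ≤ 2 := by exact_mod_cast hd2
  have h1 : 0 ≤ Real.log (2 * (4 * K * Δ₂ + 2 * K + Δ₂ * (2 / Δ₁)) + 1) :=
    Real.log_nonneg (le_add_of_nonneg_left (by positivity))
  have h2 : 0 ≤ Real.log (1 + K * (Δ₂ + 2) * (4 * K * fmax)) :=
    Real.log_nonneg (le_add_of_nonneg_right (by positivity))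
  have h3 : 0 ≤ Real.log (4 * (K * (Δ₂ + 2)) + 2) := by
    refine Real.log_nonneg ?_
    have : 0 ≤ 4 * (K * (Δ₂ + 2)) := by positivity
    linarith
  have h4 : 0 ≤ Real.log (2 * (1 + Real.log (4 * (K * (Δ₂ + 2)) + 2) +
      max 1 α / 2 * Real.log P)) := by
    refine Real.log_nonneg ?_
    have : 0 ≤ max 1 α / 2 * Real.log P := by positivity
    linarith
  have hbound : n * d * Real.log ((2 * (4 * K * Δ₂ + 2 * K + Δ₂ * (2 / Δ₁)) + 1) * (√P) ^ α)
      ≤ n * α * C + n * errorTerm K α Δ₁ Δ₂ fmax P := by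
    rw [log_mul_sqrt_rpow hP (le_add_of_nonneg_left (by positivity)), mul_assoc (n : ℝ) d,
      mul_assoc (n : ℝ) α,
      ← mul_add]
    refine mul_le_mul_of_nonneg_left ?_ n.cast_nonneg
    have h5 := mul_le_mul_of_nonneg_left hC hα
    have h6 := mul_le_mul_of_nonneg_right hd2' h1
    unfold errorTerm
    linarith
  -- The tolerance 2 covers both products: the exact ones leave 0, the rounded ones leave at most
  -- the rounding error 2.
  have hrad : ∀ g : Fin n → Fin K → Fin K → 𝕜, (∀ t i j, Δ₁ ≤ ‖g t i j‖) → ∀ t (z : 𝕜),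
      ‖g t l k * z‖ ≤ 2 → ‖z‖ ≤ 2 / Δ₁ := by
    intro g hg t z hz
    rw [le_div_iff₀ hΔ₁, mul_comm]
    rw [norm_mul] at hz
    exact (mul_le_mul_of_nonneg_right (hg t l k) (norm_nonneg z)).trans hz
  constructor
  · refine (condEntropy_output_sub_le hP hα hΔ₁ hΔ hG hX hd k
      (b := fun g x t => g t l k * x k t) (by fun_prop) ?_).trans hbound
    intro g x x' hg hb t
    refine hrad g hg t _ ?_
    have : g t l k * x k t = g t l k * x' k t := congrFun hb t
    rw [mul_sub, this, sub_self, norm_zero]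
    exact zero_le_two
  · refine (condEntropy_output_sub_le hP hα hΔ₁ hΔ hG hX hd k
      (b := fun g x t => ceil (g t l k * x k t))
      (measurable_pi_lambda _ fun t => measurable_ceil.comp (by fun_prop)) ?_).trans hbound
    intro g x x' hg hb t
    refine hrad g hg t _ ?_
    have h := norm_ceil_sub_sub_le (g t l k * x k t) (g t l k * x' k t)
    have hbt : ceil (g t l k * x k t) = ceil (g t l k * x' k t) := congrFun hb t
    rwa [hbt, sub_self, zero_sub, norm_neg, ← mul_sub] at h

theorem condEntropy_output_sub_output_le_errorTerm (hP : 1 ≤ P) (hΔ₁ : 0 < Δ₁)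
    (hΔ : Δ₁ ≤ Δ₂) {fmax : ℝ} (hf : 0 ≤ fmax)
    (hG : IsChannel μ Δ₁ Δ₂ G) (hX : IsInput μ P α G X) (hd : LatticeSum 𝕜 d) (hd2 : d ≤ 2)
    (hball : SmallBall (μ.map (channelBlock n G)) fmax d)
    {C : ℝ} (hC : d / 2 * Real.log P ≤ C) {k k' : Fin K} (hkk : k ≠ k') {j : ℕ}
    (hkj : (k : ℕ) ≤ j) :
    condEntropy μ (output P α G X k') (fun ω => (inputsUpTo j X ω, channelBlock n G ω))
        - condEntropy μ (output P α G X k) (fun ω => (inputsUpTo j X ω, channelBlock n G ω))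
      ≤ n * (max 1 α - α) * C + n * errorTerm K α Δ₁ Δ₂ fmax P := by
  have hΔ₂ : 0 < Δ₂ := hΔ₁.trans_le hΔ
  have hlogP : 0 ≤ Real.log P := Real.log_nonneg hP
  have hd2' : (d : ℝ) ≤ 2 := by exact_mod_cast hd2
  have hq : 1 ≤ √P := Real.one_le_sqrt.2 hP
  have hqe : 1 ≤ (√P) ^ max 1 α := Real.one_le_rpow hq (zero_le_one.trans (le_max_left _ _))
  have he : 0 ≤ max 1 α - α := sub_nonneg.2 (le_max_right _ _)
  have hqd : 1 ≤ (√P) ^ (max 1 α - α) := Real.one_le_rpow hq he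
  refine (condEntropy_output_sub_output_le hP hΔ₂.le hf hG hX hd hball hkk hkj).trans ?_
  have h1 : 0 ≤ Real.log (2 * (4 * K * Δ₂ + 2 * K + Δ₂ * (2 / Δ₁)) + 1) :=
    Real.log_nonneg (le_add_of_nonneg_left (by positivity))
  set L : ℝ := K * (Δ₂ + 2) with hL
  have hL0 : 0 ≤ L := by positivity
  have h2 : 0 ≤ Real.log (1 + L * (4 * K * fmax)) :=
    Real.log_nonneg (le_add_of_nonneg_right (by positivity))
  have h3 : 0 ≤ Real.log (4 * L + 2) := Real.log_nonneg (by linarith)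
  have hin : 0 ≤ max 1 α / 2 * Real.log P := by positivity
  have h4 : 0 ≤ Real.log (2 * (1 + Real.log (4 * L + 2) + max 1 α / 2 * Real.log P)) :=
    Real.log_nonneg (by linarith)
  -- The exponent of the cross gain is nonpositive: dividing by that gain multiplies by (√P)^(max 1
  -- α - α) ≥ 1, which also absorbs the summand 1.
  have hfirst : 1 + L * (4 * K * fmax / (√P) ^ (α - max 1 α))
      ≤ (1 + L * (4 * K * fmax)) * (√P) ^ (max 1 α - α) := by
    rw [← neg_sub (max 1 α) α, Real.rpow_neg (by linarith), div_inv_eq_mul, add_mul, one_mul,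
      mul_assoc L]
    linarith
  have hsecond : Real.log (4 * L * (√P) ^ max 1 α + 2)
      ≤ Real.log (4 * L + 2) + max 1 α / 2 * Real.log P := by
    rw [← log_mul_sqrt_rpow hP (by linarith)]
    exact Real.log_le_log (by positivity) (by linarith)
  have hpos : 0 ≤ Real.log (4 * L * (√P) ^ max 1 α + 2) := by
    refine Real.log_nonneg ?_
    have : 0 ≤ 4 * L * (√P) ^ max 1 α := by positivity
    linarith
  have hlog : Real.log ((1 + L * (4 * K * fmax / (√P) ^ (α - max 1 α))) *
      (2 * (1 + Real.log (4 * L * (√P) ^ max 1 α + 2))))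
      ≤ Real.log (1 + L * (4 * K * fmax)) + (max 1 α - α) / 2 * Real.log P +
        Real.log (2 * (1 + Real.log (4 * L + 2) + max 1 α / 2 * Real.log P)) := by
    rw [Real.log_mul (by positivity) (by positivity),
      ← log_mul_sqrt_rpow hP (le_add_of_nonneg_right (by positivity))]
    refine add_le_add (Real.log_le_log (by positivity) hfirst)
      (Real.log_le_log (by positivity) (by linarith))
  rw [mul_assoc (n : ℝ) d, mul_assoc (n : ℝ) (max 1 α - α), ← mul_add]
  refine mul_le_mul_of_nonneg_left ?_ n.cast_nonneg
  have h5 := mul_le_mul_of_nonneg_left hC he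
  have h6 := mul_le_mul_of_nonneg_right hd2' (add_nonneg h2 h4)
  have h7 := mul_le_mul_of_nonneg_left hlog d.cast_nonneg
  unfold errorTerm
  rw [← hL]
  linarith

end

end SymIC

theorem lemma1 (K : ℕ) (α Δ₁ Δ₂ fmax : ℝ) (hα : 0 ≤ α) (hΔ₁ : 0 < Δ₁) (hΔ : Δ₁ ≤ Δ₂)
    (hf : 0 < fmax) :
    ∃ ε : ℝ → ℝ, ε =o[atTop] Real.log ∧
      -- the real setting
      (∀ (n : ℕ) (P : ℝ), 1 ≤ P →
        ∀ (Ω : Type*) [MeasurableSpace Ω] (μ : Measure Ω) [IsProbabilityMeasure μ]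
          (G : ℕ → Fin K → Fin K → Ω → ℝ) (X : Fin K → Fin n → Ω → ℝ),
          IsChannel μ Δ₁ Δ₂ G → BoundedDensity μ (realCoefficients G) fmax →
          IsInput μ P α G X →
          (α ≤ 1 →
            (∀ k l : Fin K,
              condEntropy μ (output P α G X k) (channelBlock n G)
                  - condEntropy μ (scaledInput G X l k) (channelBlock n G)
                ≤ n * α * realCapacity P + n * ε P ∧
              condEntropy μ (output P α G X k) (channelBlock n G)
                  - condEntropy μ (roundedScaledInput G X l k) (channelBlock n G)
                ≤ n * α * realCapacity P + n * ε P) ∧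
            (∀ (k : ℕ) (hk : k + 1 < K),
              condEntropy μ (output P α G X ⟨k + 1, hk⟩)
                  (fun ω => (inputsUpTo k X ω, channelBlock n G ω))
                - condEntropy μ (output P α G X ⟨k, Nat.lt_of_succ_lt hk⟩)
                  (fun ω => (inputsUpTo k X ω, channelBlock n G ω))
                ≤ n * (1 - α) * realCapacity P + n * ε P)) ∧
          (1 < α →
            ∀ (k : ℕ) (hk : k + 1 < K),
              condEntropy μ (output P α G X ⟨k + 1, hk⟩)
                  (fun ω => (inputsUpTo k X ω, channelBlock n G ω))
                - condEntropy μ (output P α G X ⟨k, Nat.lt_of_succ_lt hk⟩)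
                  (fun ω => (inputsUpTo k X ω, channelBlock n G ω))
                ≤ n * ε P)) ∧
      -- the complex setting
      (∀ (n : ℕ) (P : ℝ), 1 ≤ P →
        ∀ (Ω : Type*) [MeasurableSpace Ω] (μ : Measure Ω) [IsProbabilityMeasure μ]
          (G : ℕ → Fin K → Fin K → Ω → ℂ) (X : Fin K → Fin n → Ω → ℂ),
          IsChannel μ Δ₁ Δ₂ G → BoundedDensity μ (complexCoefficients G) fmax →
          IsInput μ P α G X →
          (α ≤ 1 →
            (∀ k l : Fin K,
              condEntropy μ (output P α G X k) (channelBlock n G)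
                  - condEntropy μ (scaledInput G X l k) (channelBlock n G)
                ≤ n * α * complexCapacity P + n * ε P ∧
              condEntropy μ (output P α G X k) (channelBlock n G)
                  - condEntropy μ (roundedScaledInput G X l k) (channelBlock n G)
                ≤ n * α * complexCapacity P + n * ε P) ∧
            (∀ (k : ℕ) (hk : k + 1 < K),
              condEntropy μ (output P α G X ⟨k + 1, hk⟩)
                  (fun ω => (inputsUpTo k X ω, channelBlock n G ω))
                - condEntropy μ (output P α G X ⟨k, Nat.lt_of_succ_lt hk⟩)
                  (fun ω => (inputsUpTo k X ω, channelBlock n G ω))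
                ≤ n * (1 - α) * complexCapacity P + n * ε P)) ∧
          (1 < α →
            ∀ (k : ℕ) (hk : k + 1 < K),
              condEntropy μ (output P α G X ⟨k + 1, hk⟩)
                  (fun ω => (inputsUpTo k X ω, channelBlock n G ω))
                - condEntropy μ (output P α G X ⟨k, Nat.lt_of_succ_lt hk⟩)
                  (fun ω => (inputsUpTo k X ω, channelBlock n G ω))
                ≤ n * ε P)) := by
  refine ⟨errorTerm K α Δ₁ Δ₂ fmax, isLittleO_errorTerm K α Δ₁ Δ₂ fmax, ?_, ?_⟩
  · intro n P hP Ω _ μ _ G X hG hden hX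
    -- One real dimension contributes (1/2) log P; in the complex setting two dimensions give log P.
    -- Both are at most the reference capacity.
    have hC : ((1 : ℕ) : ℝ) / 2 * Real.log P ≤ realCapacity P := by
      have := Real.log_le_log (x := P) (y := 1 + P) (by linarith) (by linarith)
      rw [realCapacity, Nat.cast_one]
      linarith
    have hball := smallBall_real hG.measurable hf.le hden n
    have hcross := fun (k : ℕ) (hk : k + 1 < K) =>
      condEntropy_output_sub_output_le_errorTerm hP hΔ₁ hΔ hf.le hG hX latticeSum_real one_le_two
        hball hC (k := ⟨k, Nat.lt_of_succ_lt hk⟩) (k' := ⟨k + 1, hk⟩) (by simp) (le_refl k)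
    refine ⟨fun hα1 => ⟨fun k l => condEntropy_output_sub_le_errorTerm hP hα hΔ₁ hΔ hf.le hG hX
      latticeSum_real one_le_two hC k l, fun k hk => ?_⟩, fun hα1 k hk => ?_⟩
    -- The prefactor max 1 α - α equals 1 - α for α ≤ 1 and vanishes for α > 1, so one estimate
    -- gives both remaining claims.
    · simpa only [max_eq_left hα1] using hcross k hk
    · simpa only [max_eq_right hα1.le, sub_self, mul_zero, zero_mul, zero_add] using hcross k hk
  · intro n P hP Ω _ μ _ G X hG hden hX
    have hC : ((2 : ℕ) : ℝ) / 2 * Real.log P ≤ complexCapacity P := by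
      have := Real.log_le_log (x := P) (y := 1 + P) (by linarith) (by linarith)
      rw [complexCapacity, Nat.cast_ofNat]
      linarith
    have hball := smallBall_complex hG.measurable hf.le hden n
    have hcross := fun (k : ℕ) (hk : k + 1 < K) =>
      condEntropy_output_sub_output_le_errorTerm hP hΔ₁ hΔ hf.le hG hX latticeSum_complex le_rfl
        hball hC (k := ⟨k, Nat.lt_of_succ_lt hk⟩) (k' := ⟨k + 1, hk⟩) (by simp) (le_refl k)
    refine ⟨fun hα1 => ⟨fun k l => condEntropy_output_sub_le_errorTerm hP hα hΔ₁ hΔ hf.le hG hX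
      latticeSum_complex le_rfl hC k l, fun k hk => ?_⟩, fun hα1 k hk => ?_⟩
    · simpa only [max_eq_left hα1] using hcross k hk
    · simpa only [max_eq_right hα1.le, sub_self, mul_zero, zero_mul, zero_add] using hcross k hk
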